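/- Let $K$ be a nonempty compact connected metric space and let $\mu$ be a finite Borel measure on $K$ with $\operatorname{supp}\mu = K$. Let $L_2(K) = L_2(K,\mu)$ and $C(K)$ be the spaces of scalar-valued functions, with scalar field $\mathbb{R}$ or $\mathbb{C}$. Let $S = (S_t)_{t>0}$ be a positive $C_0$-semigroup on $L_2(K)$ (that is, $S_{s+t} = S_s S_t$ for all $s,t>0$; $S_t u \to u$ in $L_2(K)$ as $t \downarrow 0$ for all $u \in L_2(K)$; and $S_t f \ge 0$ a.e. for all $t>0$ whenever $f \ge 0$ a.e.), and suppose that its generator $-A$ is self-adjoint. Suppose that $S_t L_2(K) \subset C(K)$ for all $t>0$, i.e. every $S_t u$ has a (necessarily unique) continuous representative, and let $S^c_t = S_t|_{C(K)} \colon C(K) \to C(K)$ for all $t>0$, $S^c = (S^c_t)_{t>0}$. A subspace $I$ of $C(K)$ is called an ideal if $u \in I$ implies $|u| \in I$, and if $u \in I$, $v \in C(K)$ and $0 \le v \le u$ imply $v \in I$. The semigroup $S^c$ is called irreducible if the only closed ideals of $C(K)$ which are invariant under all $S^c_t$, $t>0$, are $\{0\}$ and $C(K)$. (a) The minimum $\min\sigma(A)$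 of the spectrum of $A$ exists and is an eigenvalue of $A$ with an eigenfunction $u_1 \in L_2(K)$ such that $u_1 \ge 0$ a.e. (b) Let $u_1 \in L_2(K)$ be any eigenfunction of $A$ with eigenvalue $\min\sigma(A)$ such that $u_1 \ge 0$ a.e. Then the following are equivalent. 1. The semigroup $S^c$ is irreducible. 2. For all $x \in K$ there exist $t>0$ and $f \in C(K)$ such that $(S^c_t f)(x) \ne 0$. 3. The function $u_1$ has a continuous representative, and there exists a $\delta>0$ such that this representative satisfies $u_1(x) \ge \delta$ for all $x \in K$. 4. For all $f \in C(K)$ with $f \ge 0$ and $f \ne 0$ one has $(S^c_t f)(x) > 0$ for all $t>0$ and $x \in K$. (c) If $S^c$ is a $C_0$-semigroup on $C(K)$, then $S^c$ is irreducible and every $u_1$ as in (b) has a continuous representative, which satisfies $\min_{x\in K} u_1(x) > 0$. -/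

import Mathlib

open MeasureTheory Filter Topology
open scoped ComplexOrder

noncomputable section

namespace SemigroupCK

section Banach

variable {𝕜 : Type*} [RCLike 𝕜] {X : Type*} [NormedAddCommGroup X] [NormedSpace 𝕜 X]

/-- A semigroup `(S_t)_{t > 0}` of bounded operators on a normed space, without any continuity
assumption. Only the values of `S` on `(0, ∞)` matter. -/
def IsSemigroup (S : ℝ → X →L[𝕜] X) : Prop :=
  ∀ s t : ℝ, 0 < s → 0 < t → S (s + t) = (S s).comp (S t)

/-- A `C_0`-semigroup: `S_t u → u` as `t ↓ 0`, for all `u`. -/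
structure IsC0Semigroup (S : ℝ → X →L[𝕜] X) : Prop where
  isSemigroup : IsSemigroup S
  tendsto_zero : ∀ u : X, Tendsto (fun t => S t u) (𝓝[>] 0) (𝓝 u)

/-- All pairs `(u, v)` such that `(S_t u - u) / t → v` as `t ↓ 0`. -/
def generatorGraph (S : ℝ → X →L[𝕜] X) : Submodule 𝕜 (X × X) where
  carrier := {p | Tendsto (fun t : ℝ => ((t⁻¹ : ℝ) : 𝕜) • (S t p.1 - p.1)) (𝓝[>] 0) (𝓝 p.2)}
  zero_mem' := by simp
  add_mem' := by
    intro p q hp hq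
    refine (Tendsto.add hp hq).congr fun t => ?_
    simp only [Prod.fst_add, map_add, ← smul_add]
    congr 1
    abel
  smul_mem' := by
    intro c p hp
    refine (Tendsto.const_smul hp c).congr fun t => ?_
    simp only [Prod.smul_fst, map_smul, ← smul_sub]
    exact smul_comm _ _ _

/-- The (infinitesimal) generator of a semigroup, as an unbounded operator whose domain consists
of all `u` such that `(S_t u - u) / t` converges as `t ↓ 0`. -/
def generator (S : ℝ → X →L[𝕜] X) : X →ₗ.[𝕜] X :=
  (generatorGraph S).toLinearPMap

theorem mem_graph_generator (S : ℝ → X →L[𝕜] X) (u v : X) :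
    (u, v) ∈ (generator S).graph ↔
      Tendsto (fun t : ℝ => ((t⁻¹ : ℝ) : 𝕜) • (S t u - u)) (𝓝[>] 0) (𝓝 v) := by
  have h : ∀ p ∈ generatorGraph S, p.1 = 0 → p.2 = 0 := by
    rintro ⟨p, q⟩ hp rfl
    have hp' : Tendsto (fun t : ℝ => ((t⁻¹ : ℝ) : 𝕜) • (S t 0 - 0)) (𝓝[>] 0) (𝓝 q) := hp
    simp only [map_zero, sub_zero, smul_zero] at hp'
    exact tendsto_nhds_unique hp' tendsto_const_nhds
  rw [generator, Submodule.toLinearPMap_graph_eq _ h]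
  rfl

/-- `z` is in the resolvent set of the unbounded operator `A`: the operator `z - A` is a bijection
from the domain of `A` onto `X` with bounded inverse `R`. -/
def InResolventSet (A : X →ₗ.[𝕜] X) (z : 𝕜) : Prop :=
  ∃ R : X →L[𝕜] X,
    (∀ u : X, ∃ h : R u ∈ A.domain, z • R u - A ⟨R u, h⟩ = u) ∧
    ∀ u : A.domain, R (z • (u : X) - A u) = u

/-- The spectrum of an unbounded operator. -/
def unboundedSpectrum (A : X →ₗ.[𝕜] X) : Set 𝕜 := {z | ¬ InResolventSet A z}

/-- `u` is an eigenvector of the unbounded operator `A` with eigenvalue `z`. -/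
def IsEigenvector (A : X →ₗ.[𝕜] X) (z : 𝕜) (u : X) : Prop :=
  u ≠ 0 ∧ ∃ h : u ∈ A.domain, A ⟨u, h⟩ = z • u

end Banach

section Ideals

variable {𝕜 : Type*} [RCLike 𝕜] {K : Type*} [TopologicalSpace K] [CompactSpace K]

/-- The modulus `|f|` of a continuous function. -/
def modulus (f : C(K, 𝕜)) : C(K, 𝕜) where
  toFun x := ((‖f x‖ : ℝ) : 𝕜)
  continuous_toFun := RCLike.continuous_ofReal.comp f.continuous.norm

/-- Ideals of the Banach lattice `C(K)`. Over `ℂ`, the condition `0 ≤ v ≤ u` includes that `u` and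
`v` are real-valued. -/
structure IsLatticeIdeal (I : Submodule 𝕜 C(K, 𝕜)) : Prop where
  modulus_mem : ∀ u ∈ I, modulus u ∈ I
  mem_of_le : ∀ u ∈ I, ∀ v : C(K, 𝕜), (∀ x, 0 ≤ v x) → (∀ x, v x ≤ u x) → v ∈ I

/-- A semigroup on `C(K)` is irreducible if the only invariant closed ideals are `{0}` and
`C(K)`. -/
def IsIrreducible (T : ℝ → C(K, 𝕜) →L[𝕜] C(K, 𝕜)) : Prop :=
  ∀ I : Submodule 𝕜 C(K, 𝕜), IsClosed (I : Set C(K, 𝕜)) → IsLatticeIdeal I →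
    (∀ t : ℝ, 0 < t → ∀ f ∈ I, T t f ∈ I) → I = ⊥ ∨ I = ⊤

end Ideals

section L2

variable {𝕜 : Type*} [RCLike 𝕜] {K : Type*} [MetricSpace K] [CompactSpace K]
  [MeasurableSpace K] [BorelSpace K] {μ : Measure K} [IsFiniteMeasure μ]

/-- A semigroup on `L_2(K, μ)` is positive if every `S_t` maps functions that are `≥ 0` almost
everywhere to such functions. -/
def IsPositive (S : ℝ → Lp 𝕜 2 μ →L[𝕜] Lp 𝕜 2 μ) : Prop :=
  ∀ t : ℝ, 0 < t → ∀ f : Lp 𝕜 2 μ, (∀ᵐ x ∂μ, 0 ≤ f x) → ∀ᵐ x ∂μ, 0 ≤ S t f x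

/-- `T L_2(K) ⊆ C(K)`: every `T u` has a continuous representative. -/
def MapsToC (T : Lp 𝕜 2 μ →L[𝕜] Lp 𝕜 2 μ) : Prop :=
  ∀ u : Lp 𝕜 2 μ, ∃ g : C(K, 𝕜), ContinuousMap.toLp 2 μ 𝕜 g = T u

/-- `u` is a nonnegative eigenfunction of `A` with eigenvalue `min σ(A)`. -/
def IsFirstEigenfunction (A : Lp 𝕜 2 μ →ₗ.[𝕜] Lp 𝕜 2 μ) (u : Lp 𝕜 2 μ) : Prop :=
  ∃ z : 𝕜, IsLeast (unboundedSpectrum A) z ∧ IsEigenvector A z u ∧ ∀ᵐ x ∂μ, 0 ≤ u x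

variable [μ.IsOpenPosMeasure]

/-- The restriction `T|_{C(K)} : C(K) → C(K)` of an operator `T` on `L_2(K, μ)` with
`T L_2(K) ⊆ C(K)`. It is bounded by the closed graph theorem. -/
def restrictOp (T : Lp 𝕜 2 μ →L[𝕜] Lp 𝕜 2 μ) (hT : MapsToC T) : C(K, 𝕜) →L[𝕜] C(K, 𝕜) :=
  ContinuousLinearMap.ofSeqClosedGraph
    (g :=
      { toFun := fun f => (hT (ContinuousMap.toLp 2 μ 𝕜 f)).choose
        map_add' := fun f g => by
          apply ContinuousMap.toLp_injective (p := 2) (𝕜 := 𝕜) μ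
          rw [(hT _).choose_spec, map_add, map_add, map_add, (hT _).choose_spec, (hT _).choose_spec]
        map_smul' := fun c f => by
          apply ContinuousMap.toLp_injective (p := 2) (𝕜 := 𝕜) μ
          rw [(hT _).choose_spec, RingHom.id_apply, map_smul, map_smul, map_smul, (hT _).choose_spec] })
    (by
      intro u x y hu hy
      apply ContinuousMap.toLp_injective (p := 2) (𝕜 := 𝕜) μ
      have h1 := ((ContinuousMap.toLp (E := 𝕜) 2 μ 𝕜).continuous.tendsto y).comp hy
      have h2 := (T.continuous.comp (ContinuousMap.toLp (E := 𝕜) 2 μ 𝕜).continuous).tendsto x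
        |>.comp hu
      refine (tendsto_nhds_unique h1 (h2.congr fun n => ?_)).trans ?_
      · exact ((hT (ContinuousMap.toLp 2 μ 𝕜 (u n))).choose_spec).symm
      · exact ((hT (ContinuousMap.toLp 2 μ 𝕜 x)).choose_spec).symm)

theorem toLp_restrictOp (T : Lp 𝕜 2 μ →L[𝕜] Lp 𝕜 2 μ) (hT : MapsToC T) (f : C(K, 𝕜)) :
    ContinuousMap.toLp 2 μ 𝕜 (restrictOp T hT f) = T (ContinuousMap.toLp 2 μ 𝕜 f) :=
  (hT (ContinuousMap.toLp 2 μ 𝕜 f)).choose_spec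

open Classical in
/-- The restricted family `S^c_t = S_t|_{C(K)}` for `t > 0` (the identity for `t ≤ 0`, which is
irrelevant). -/
def restrictSemigroup (S : ℝ → Lp 𝕜 2 μ →L[𝕜] Lp 𝕜 2 μ) (hS : ∀ t : ℝ, 0 < t → MapsToC (S t))
    (t : ℝ) : C(K, 𝕜) →L[𝕜] C(K, 𝕜) :=
  if ht : 0 < t then restrictOp (S t) (hS t ht) else ContinuousLinearMap.id 𝕜 C(K, 𝕜)

theorem toLp_restrictSemigroup (S : ℝ → Lp 𝕜 2 μ →L[𝕜] Lp 𝕜 2 μ)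
    (hS : ∀ t : ℝ, 0 < t → MapsToC (S t)) {t : ℝ} (ht : 0 < t) (f : C(K, 𝕜)) :
    ContinuousMap.toLp 2 μ 𝕜 (restrictSemigroup S hS t f) = S t (ContinuousMap.toLp 2 μ 𝕜 f) := by
  rw [restrictSemigroup, dif_pos ht, toLp_restrictOp]

end L2

end SemigroupCK

end

/-!
Three facts about the semigroup `S` carry the proof.

*Symmetry.* As `A` is self-adjoint, `s ↦ ⟪S_{t-s} u, S_s v⟫` is constant on `[0, t]` for `u, v` in
the domain of `A`, so that every `S_t` is symmetric (`inner_semigroup_eq`). Hence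
`S_t = S_{t/2} ^ 2` is positive semidefinite and injective, and `‖S_t‖ = ‖S_{t/2}‖ ^ 2`.

*Smoothing.* By the closed graph theorem `S_t` is bounded from `L_2(K)` to `C(K)`, and so
`(S_t f)(x) = ⟪k_{t,x}, f⟫` with `k_{t,x} ≥ 0` in `L_2(K)`. It follows that `S_t` is compact
(`isCompact_image_closedBall`). Moreover `k_{t,x} = S_{t/2} k_{t/2,x}` has a continuous
representative `p_t(x, ·)` with `p_t(x, x) = ‖k_{t/2,x}‖ ^ 2` (`continuousKernel`).

*Analyticity.* By expansion into the eigenvectors of `S_1`, the functions `s ↦ ⟪g, S_s h⟫` extend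
to holomorphic functions (`re_inner_semigroup_eq_zero`).

The norm of `S_{1/2}` is attained at a nonnegative `u`, as `|S_{1/2} f| ≤ S_{1/2} |f|`, and then
`S_1 u = ‖S_1‖ u`. Taking square roots and powers gives `S_t u = ‖S_1‖ ^ t u`, and so `u` is an
eigenvector of `A` for `-log ‖S_1‖`; the spectrum lies above this number because it is a lower
bound of the self-adjoint operator `A` (`isLeast_unboundedSpectrum`).

For the equivalences, if all `S_t f` vanish at `x`, then the ideal of functions vanishing at `x` is
invariant, which excludes irreducibility (`IsIrreducible.exists_apply_ne_zero`). If there is no such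
`x`, then `p_t(x, x) > 0` everywhere. Thus the set of zeros of the continuous representative of the
eigenfunction is open and closed, and it is empty as `K` is connected
(`exists_toLp_eq_and_forall_pos`). The same argument, applied to the set of all `y` such that
`p_s(x, y) = 0` for all `s`, together with analyticity in `s`, yields `p_t(x, y) > 0` for all `t`,
`x` and `y` (`continuousKernel_ne_zero`), which is strict positivity of `S_t`. Finally, an invariant
ideal that is not zero contains a function bounded below by a positive constant, and therefore it
is everything (`IsLatticeIdeal.eq_top`).
-/

noncomputable section

namespace SemigroupCK

/-! ### Joint continuity of semigroups -/

section Extension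

variable {𝕜 : Type*} [RCLike 𝕜] {X : Type*} [NormedAddCommGroup X] [NormedSpace 𝕜 X]
  {S : ℝ → X →L[𝕜] X}

/-- The semigroup `S` completed by the identity at time `0`, so that it is defined on `[0, ∞)`. -/
def extendZero (S : ℝ → X →L[𝕜] X) (t : ℝ) : X →L[𝕜] X :=
  open Classical in if 0 < t then S t else ContinuousLinearMap.id 𝕜 X

theorem extendZero_of_pos {t : ℝ} (ht : 0 < t) : extendZero S t = S t := if_pos ht

theorem extendZero_zero : extendZero S 0 = ContinuousLinearMap.id 𝕜 X := if_neg (lt_irrefl 0)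

theorem IsSemigroup.extendZero_add (hS : IsSemigroup S) {s t : ℝ} (hs : 0 ≤ s) (ht : 0 ≤ t)
    (u : X) : extendZero S (s + t) u = extendZero S s (extendZero S t u) := by
  rcases hs.eq_or_lt with rfl | hs
  · simp [extendZero_zero]
  rcases ht.eq_or_lt with rfl | ht
  · simp [extendZero_zero]
  rw [extendZero_of_pos hs, extendZero_of_pos ht, extendZero_of_pos (add_pos hs ht), hS s t hs ht]
  rfl

theorem IsSemigroup.add_apply (hS : IsSemigroup S) {s t : ℝ} (hs : 0 < s) (ht : 0 < t) (u : X) :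
    S (s + t) u = S s (S t u) := by
  rw [hS s t hs ht]; rfl

theorem IsC0Semigroup.tendsto_extendZero (hS : IsC0Semigroup S) (u : X) :
    Tendsto (fun t => extendZero S t u) (𝓝[≥] 0) (𝓝 u) := by
  rw [← Set.Ioi_union_left, nhdsWithin_union, nhdsWithin_singleton, tendsto_sup]
  refine ⟨(hS.tendsto_zero u).congr' ?_, ?_⟩
  · filter_upwards [self_mem_nhdsWithin] with t ht
    rw [extendZero_of_pos ht]
  · rw [tendsto_pure_left]
    intro s hs
    rw [extendZero_zero]
    exact mem_of_mem_nhds hs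

/-- Near time `0` this is the uniform boundedness principle, applied to a sequence of times. -/
theorem IsC0Semigroup.exists_bound_near_zero [CompleteSpace X] (hS : IsC0Semigroup S) :
    ∃ δ > 0, ∃ M : ℝ, 1 ≤ M ∧ ∀ t, 0 ≤ t → t ≤ δ → ‖extendZero S t‖ ≤ M := by
  by_contra! h
  have h' : ∀ n : ℕ, ∃ t : ℝ, 0 ≤ t ∧ t ≤ 1 / ((n : ℝ) + 1) ∧ (n : ℝ) + 1 < ‖extendZero S t‖ := by
    intro n
    obtain ⟨t, h0, h1, h2⟩ := h (1 / ((n : ℝ) + 1)) (by positivity) (n + 1) (by simp)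
    exact ⟨t, h0, h1, h2⟩
  choose t ht0 ht1 ht2 using h'
  have hlim : Tendsto t atTop (𝓝[≥] 0) := by
    refine tendsto_nhdsWithin_iff.2 ⟨?_, Eventually.of_forall ht0⟩
    exact squeeze_zero ht0 ht1 tendsto_one_div_add_atTop_nhds_zero_nat
  obtain ⟨C, hC⟩ := banach_steinhaus (g := fun n => extendZero S (t n)) (fun u => by
    obtain ⟨C, hC⟩ := ((hS.tendsto_extendZero u).comp hlim).norm.bddAbove_range
    exact ⟨C, fun n => hC ⟨n, rfl⟩⟩)
  obtain ⟨n, hn⟩ := exists_nat_gt C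
  linarith [hC n, ht2 n]

theorem IsC0Semigroup.exists_bound [CompleteSpace X] (hS : IsC0Semigroup S) (R : ℝ) :
    ∃ M : ℝ, 0 ≤ M ∧ ∀ t, 0 ≤ t → t ≤ R → ‖extendZero S t‖ ≤ M := by
  obtain ⟨δ, hδ, M, hM, hb⟩ := hS.exists_bound_near_zero
  have key : ∀ n : ℕ, ∀ t, 0 ≤ t → t ≤ n * δ → ‖extendZero S t‖ ≤ M ^ (n + 1) := by
    intro n
    induction n with
    | zero =>
      intro t h0 h1
      simpa using hb t h0 (by push_cast at h1; linarith)
    | succ n ih =>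
      intro t h0 h1
      rcases le_total t δ with h | h
      · exact (hb t h0 h).trans (le_self_pow₀ hM (by omega))
      · have e : extendZero S t = (extendZero S δ).comp (extendZero S (t - δ)) := by
          ext u
          rw [ContinuousLinearMap.comp_apply,
            ← hS.isSemigroup.extendZero_add hδ.le (sub_nonneg.2 h), add_sub_cancel]
        rw [e, pow_succ']
        push_cast at h1
        exact (ContinuousLinearMap.opNorm_comp_le _ _).trans (mul_le_mul (hb δ hδ.le le_rfl)
          (ih _ (sub_nonneg.2 h) (by linarith)) (norm_nonneg _) (by linarith))
  obtain ⟨n, hn⟩ := exists_nat_gt (R / δ)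
  refine ⟨M ^ (n + 1), by positivity, fun t h0 h1 => key n t h0 (h1.trans ?_)⟩
  exact ((div_lt_iff₀ hδ).1 hn).le

/-- A `C_0`-semigroup is jointly continuous in time and initial value. -/
theorem IsC0Semigroup.continuousOn_extendZero [CompleteSpace X] (hS : IsC0Semigroup S) :
    ContinuousOn (fun p : ℝ × X => extendZero S p.1 p.2) (Set.Ici 0 ×ˢ Set.univ) := by
  rintro ⟨b, x⟩ ⟨hb, -⟩
  obtain ⟨M, hM0, hM⟩ := hS.exists_bound (b + 1)
  have hb' : (0 : ℝ) ≤ b := hb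
  -- by the semigroup law, continuity at all times reduces to continuity at time zero
  have mono : ∀ c d : ℝ, 0 ≤ c → c ≤ d → d ≤ b + 1 →
      ‖extendZero S d x - extendZero S c x‖ ≤ M * ‖extendZero S |d - c| x - x‖ := by
    intro c d hc hcd hd
    have : extendZero S d x = extendZero S c (extendZero S (d - c) x) := by
      rw [← hS.isSemigroup.extendZero_add hc (sub_nonneg.2 hcd), add_sub_cancel]
    rw [this, ← map_sub, abs_of_nonneg (sub_nonneg.2 hcd)]
    exact (extendZero S c).le_of_opNorm_le (hM c hc (hcd.trans hd)) _
  have h1 : Tendsto (fun p : ℝ × X => extendZero S |p.1 - b| x)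
      (𝓝[Set.Ici 0 ×ˢ Set.univ] (b, x)) (𝓝 x) := by
    refine (hS.tendsto_extendZero x).comp (tendsto_nhdsWithin_iff.2
      ⟨?_, Eventually.of_forall fun p => Set.mem_Ici.2 (abs_nonneg _)⟩)
    have : Tendsto (fun p : ℝ × X => |p.1 - b|) (𝓝 (b, x)) (𝓝 |b - b|) :=
      (Continuous.abs (continuous_fst.sub continuous_const)).tendsto (b, x)
    rw [sub_self, abs_zero] at this
    exact this.mono_left nhdsWithin_le_nhds
  have h2 : Tendsto (fun p : ℝ × X => p.2) (𝓝[Set.Ici 0 ×ˢ Set.univ] (b, x)) (𝓝 x) :=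
    (continuous_snd.tendsto (b, x)).mono_left nhdsWithin_le_nhds
  have h3 : Tendsto (fun p : ℝ × X => M * ‖p.2 - x‖ + M * ‖extendZero S |p.1 - b| x - x‖)
      (𝓝[Set.Ici 0 ×ˢ Set.univ] (b, x)) (𝓝 0) := by
    simpa using ((h2.sub_const x).norm.const_mul M).add ((h1.sub_const x).norm.const_mul M)
  refine tendsto_iff_norm_sub_tendsto_zero.2 (squeeze_zero' (Eventually.of_forall fun p =>
    norm_nonneg _) ?_ h3)
  have hlt : ∀ᶠ p : ℝ × X in 𝓝[Set.Ici 0 ×ˢ Set.univ] (b, x), p.1 < b + 1 :=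
    ((continuous_fst.tendsto (b, x)).eventually_lt_const (by simp)).filter_mono nhdsWithin_le_nhds
  filter_upwards [hlt, self_mem_nhdsWithin] with p hp hp'
  have hp0 : 0 ≤ p.1 := hp'.1
  have e : extendZero S p.1 p.2 - extendZero S b x
      = extendZero S p.1 (p.2 - x) + (extendZero S p.1 x - extendZero S b x) := by
    rw [map_sub]; abel
  rw [e]
  refine (norm_add_le _ _).trans (add_le_add ((extendZero S p.1).le_of_opNorm_le
    (hM _ hp0 hp.le) _) ?_)
  rcases le_total p.1 b with h | h
  · rw [norm_sub_rev, abs_sub_comm]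
    exact mono _ _ hp0 h (by linarith)
  · exact mono _ _ hb' h hp.le

theorem IsC0Semigroup.tendsto_extendZero_apply [CompleteSpace X] (hS : IsC0Semigroup S)
    {α : Type*} {l : Filter α} {τ : α → ℝ} {v : α → X} {s : ℝ} {x : X} (hs : 0 ≤ s)
    (hτ : Tendsto τ l (𝓝 s)) (hτ0 : ∀ᶠ a in l, 0 ≤ τ a) (hv : Tendsto v l (𝓝 x)) :
    Tendsto (fun a => extendZero S (τ a) (v a)) l (𝓝 (extendZero S s x)) := by
  have h := hS.continuousOn_extendZero (s, x) ⟨hs, trivial⟩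
  refine Tendsto.comp (g := fun p : ℝ × X => extendZero S p.1 p.2) h
    (tendsto_nhdsWithin_iff.2 ⟨hτ.prodMk_nhds hv, ?_⟩)
  filter_upwards [hτ0] with a ha using ⟨ha, trivial⟩

end Extension

/-! ### The generator and symmetry of the semigroup -/

section Generator

variable {𝕜 : Type*} [RCLike 𝕜] {X : Type*} [NormedAddCommGroup X] [NormedSpace 𝕜 X]
  {S : ℝ → X →L[𝕜] X} {A : X →ₗ.[𝕜] X}

theorem tendsto_of_mem_domain (hA : generator S = -A) (u : A.domain) :
    Tendsto (fun t : ℝ => ((t⁻¹ : ℝ) : 𝕜) • (S t u - u)) (𝓝[>] 0) (𝓝 (-(A u))) := by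
  rw [← mem_graph_generator S, hA, LinearPMap.mem_graph_iff]
  exact ⟨⟨u, u.2⟩, rfl, rfl⟩

/-- Membership in the domain of `A` is convergence of the difference quotients of `S`. -/
theorem exists_mem_domain_of_tendsto (hA : generator S = -A) {u v : X}
    (h : Tendsto (fun t : ℝ => ((t⁻¹ : ℝ) : 𝕜) • (S t u - u)) (𝓝[>] 0) (𝓝 v)) :
    ∃ hu : u ∈ A.domain, A ⟨u, hu⟩ = -v := by
  rw [← mem_graph_generator S, hA, LinearPMap.mem_graph_iff] at h
  obtain ⟨y, rfl, rfl⟩ := h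
  exact ⟨y.2, by rw [LinearPMap.neg_apply, neg_neg]; rfl⟩

/-- The semigroup preserves the domain of its generator and commutes with it. -/
theorem exists_mem_domain_extendZero (hS : IsSemigroup S) (hA : generator S = -A) {s : ℝ}
    (hs : 0 ≤ s) (u : A.domain) :
    ∃ hu : extendZero S s u ∈ A.domain, A ⟨_, hu⟩ = extendZero S s (A u) := by
  have h := ((extendZero S s).continuous.tendsto _).comp (tendsto_of_mem_domain hA u)
  obtain ⟨hu, e⟩ := exists_mem_domain_of_tendsto hA
    (u := extendZero S s u) (v := extendZero S s (-(A u))) (by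
      refine h.congr' ?_
      filter_upwards [self_mem_nhdsWithin] with t ht
      have ht' : 0 < t := ht
      rw [Function.comp_apply, map_smul, map_sub, ← extendZero_of_pos (S := S) ht',
        ← hS.extendZero_add ht'.le hs, ← hS.extendZero_add hs ht'.le, add_comm])
  exact ⟨hu, by rw [e, map_neg, neg_neg]⟩

end Generator

section Hilbert

variable {𝕜 : Type*} [RCLike 𝕜] {H : Type*} [NormedAddCommGroup H] [InnerProductSpace 𝕜 H]
  [CompleteSpace H] {S : ℝ → H →L[𝕜] H} {A : H →ₗ.[𝕜] H}

local notation "⟪" x ", " y "⟫" => inner 𝕜 x y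

theorem inner_apply_eq_of_isSelfAdjoint (hsa : IsSelfAdjoint A) (u v : A.domain) :
    ⟪A u, (v : H)⟫ = ⟪(u : H), A v⟫ := by
  have h := LinearPMap.adjoint_isFormalAdjoint hsa.dense_domain
  rw [LinearPMap.isSelfAdjoint_def.1 hsa] at h
  exact h u v

theorem hasDerivWithinAt_of_tendsto {E : Type*} [NormedAddCommGroup E] [NormedSpace ℝ E]
    {f : ℝ → E} {f' : E} {s : ℝ}
    (h : Tendsto (fun h : ℝ => h⁻¹ • (f (s + h) - f s)) (𝓝[>] 0) (𝓝 f')) :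
    HasDerivWithinAt f f' (Set.Ici s) s := by
  rw [← hasDerivWithinAt_Ioi_iff_Ici, hasDerivWithinAt_iff_tendsto_slope' (by simp)]
  have h2 : Tendsto (fun x : ℝ => x - s) (𝓝[>] s) (𝓝[>] 0) := by
    refine tendsto_nhdsWithin_iff.2 ⟨?_, ?_⟩
    · have : Tendsto (fun x : ℝ => x - s) (𝓝 s) (𝓝 (s - s)) := by
        apply Continuous.tendsto; fun_prop
      rw [sub_self] at this
      exact this.mono_left nhdsWithin_le_nhds
    · filter_upwards [self_mem_nhdsWithin] with x hx
      exact Set.mem_Ioi.2 (sub_pos.2 hx)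
  refine (h.comp h2).congr fun x => ?_
  simp [slope_def_module]

/-- The operators of the semigroup are symmetric: for `u, v` in the domain of `A`, the function
`s ↦ ⟪S_{t-s} u, S_s v⟫` has derivative zero. -/
theorem inner_semigroup_eq (hS : IsC0Semigroup S) (hA : generator S = -A) (hsa : IsSelfAdjoint A)
    {t : ℝ} (ht : 0 < t) (u v : H) : ⟪S t u, v⟫ = ⟪u, S t v⟫ := by
  have dom : ∀ u v : A.domain, ⟪S t u, (v : H)⟫ = ⟪(u : H), S t v⟫ := by
    intro u v
    have hcont : ContinuousOn (fun s => ⟪extendZero S (t - s) u, extendZero S s v⟫)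
        (Set.Icc 0 t) := by
      intro s hs
      refine Tendsto.inner (hS.tendsto_extendZero_apply (sub_nonneg.2 hs.2) ?_ ?_
        tendsto_const_nhds) (hS.tendsto_extendZero_apply hs.1 ?_ ?_ tendsto_const_nhds)
      · exact ((continuous_const.sub continuous_id).tendsto s).mono_left nhdsWithin_le_nhds
      · filter_upwards [self_mem_nhdsWithin] with a ha using sub_nonneg.2 ha.2
      · exact tendsto_id.mono_left nhdsWithin_le_nhds
      · filter_upwards [self_mem_nhdsWithin] with a ha using ha.1
    have hderiv : ∀ s ∈ Set.Ico 0 t, HasDerivWithinAt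
        (fun s => ⟪extendZero S (t - s) u, extendZero S s v⟫) 0 (Set.Ici s) s := by
      intro s hs
      refine hasDerivWithinAt_of_tendsto ?_
      have hh : Tendsto (fun h : ℝ => t - (s + h)) (𝓝[>] 0) (𝓝 (t - s)) := by
        have : Tendsto (fun h : ℝ => t - (s + h)) (𝓝 0) (𝓝 (t - (s + 0))) := by
          apply Continuous.tendsto; fun_prop
        rw [add_zero] at this
        exact this.mono_left nhdsWithin_le_nhds
      have hlt : ∀ᶠ h : ℝ in 𝓝[>] 0, 0 ≤ t - (s + h) := by
        filter_upwards [hh.eventually_const_le (sub_pos.2 hs.2)] with h hh using hh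
      have hts : 0 ≤ t - s := sub_nonneg.2 hs.2.le
      have h1 := hS.tendsto_extendZero_apply (x := (u : H)) hts hh hlt tendsto_const_nhds
      have h2 := hS.tendsto_extendZero_apply hts hh hlt (tendsto_of_mem_domain hA u)
      have h3 := ((extendZero S s).continuous.tendsto _).comp (tendsto_of_mem_domain hA v)
      have h4 := (h1.inner (𝕜 := 𝕜) h3).sub (h2.inner (𝕜 := 𝕜)
        (tendsto_const_nhds (x := extendZero S s v)))
      -- the derivative vanishes, since `A` is symmetric and commutes with the semigroup
      have e0 : ⟪extendZero S (t - s) u, extendZero S s (-(A v))⟫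
          - ⟪extendZero S (t - s) (-(A u)), extendZero S s v⟫ = 0 := by
        obtain ⟨m1, e1⟩ := exists_mem_domain_extendZero hS.isSemigroup hA hs.1 v
        obtain ⟨m2, e2⟩ := exists_mem_domain_extendZero hS.isSemigroup hA hts u
        have := inner_apply_eq_of_isSelfAdjoint hsa ⟨_, m2⟩ ⟨_, m1⟩
        rw [map_neg, map_neg, inner_neg_left, inner_neg_right, ← e1, ← e2, this, sub_self]
      rw [e0] at h4
      refine h4.congr' ?_
      filter_upwards [self_mem_nhdsWithin, hlt] with h hpos hle
      have hpos' : 0 < h := hpos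
      have a1 : extendZero S (s + h) (v : H) = extendZero S s (S h v) := by
        rw [hS.isSemigroup.extendZero_add hs.1 hpos'.le, extendZero_of_pos hpos']
      have a2 : extendZero S (t - s) (u : H) = extendZero S (t - (s + h)) (S h u) := by
        rw [← extendZero_of_pos (S := S) hpos', ← hS.isSemigroup.extendZero_add hle hpos'.le]
        congr 2; ring
      rw [a1, a2]
      simp only [Function.comp_apply, map_smul, map_sub, inner_smul_right, inner_smul_left,
        inner_sub_left, inner_sub_right, RCLike.conj_ofReal, RCLike.real_smul_eq_coe_mul]
      ring
    have := constant_of_has_deriv_right_zero hcont hderiv t ⟨ht.le, le_rfl⟩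
    simpa [extendZero_zero, extendZero_of_pos ht] using this.symm
  have hd := hsa.dense_domain
  have step : ∀ (v : A.domain) (u : H), ⟪S t u, (v : H)⟫ = ⟪u, S t v⟫ := by
    intro v u
    refine congrFun (Continuous.ext_on hd ?_ ?_ fun x hx => ?_ :
      (fun u => ⟪S t u, (v : H)⟫) = fun u => ⟪u, S t v⟫) u
    · fun_prop
    · fun_prop
    · exact dom ⟨x, hx⟩ v
  refine congrFun (Continuous.ext_on hd ?_ ?_ fun x hx => ?_ :
    (fun v => ⟪S t u, (v : H)⟫) = fun v => ⟪u, S t v⟫) v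
  · fun_prop
  · fun_prop
  · exact step ⟨x, hx⟩ u

/-- On an eigenvector of the generator with real eigenvalue the semigroup acts by the exponential
function, by uniqueness for the corresponding linear differential equation. -/
theorem semigroup_apply_of_isEigenvector (hS : IsC0Semigroup S) (hA : generator S = -A)
    {r : ℝ} {u : H} (hu : IsEigenvector A (r : 𝕜) u) {t : ℝ} (ht : 0 < t) :
    S t u = ((Real.exp (-(r * t)) : ℝ) : 𝕜) • u := by
  obtain ⟨-, hu, hAu⟩ := hu
  -- `s ↦ exp (r s) ⟪w, S_s u⟫` has derivative zero
  have main : ∀ w : H, ((Real.exp (r * t) : ℝ) : 𝕜) * ⟪w, S t u⟫ = ⟪w, u⟫ := by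
    intro w
    have hT : ∀ s, 0 ≤ s → HasDerivWithinAt (fun s => ⟪w, extendZero S s u⟫)
        (-(r : 𝕜) * ⟪w, extendZero S s u⟫) (Set.Ici s) s := by
      intro s hs
      refine hasDerivWithinAt_of_tendsto ?_
      have h3 := ((extendZero S s).continuous.tendsto _).comp (tendsto_of_mem_domain hA ⟨u, hu⟩)
      have h4 := (tendsto_const_nhds (x := w)).inner (𝕜 := 𝕜) h3
      rw [hAu, map_neg, map_smul, inner_neg_right, inner_smul_right, ← neg_mul] at h4
      refine h4.congr' ?_
      filter_upwards [self_mem_nhdsWithin] with h hpos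
      have hpos' : 0 < h := hpos
      rw [hS.isSemigroup.extendZero_add hs hpos'.le, extendZero_of_pos hpos']
      simp only [Function.comp_apply, map_smul, map_sub, inner_smul_right,
        inner_sub_right, RCLike.real_smul_eq_coe_mul]
    have hexp : ∀ s : ℝ, HasDerivAt (fun s : ℝ => ((Real.exp (r * s) : ℝ) : 𝕜))
        ((Real.exp (r * s) * r : ℝ) : 𝕜) s := by
      intro s
      have h := ((hasDerivAt_id s).const_mul r).exp
      simp only [id, mul_one] at h
      exact (RCLike.ofRealCLM (K := 𝕜)).hasFDerivAt.comp_hasDerivAt s h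
    have hcont : ContinuousOn (fun s => ((Real.exp (r * s) : ℝ) : 𝕜) * ⟪w, extendZero S s u⟫)
        (Set.Icc 0 t) := by
      intro s hs
      refine ((hexp s).continuousAt.continuousWithinAt).mul (tendsto_const_nhds.inner
        (hS.tendsto_extendZero_apply hs.1 (tendsto_id.mono_left nhdsWithin_le_nhds) ?_
        tendsto_const_nhds))
      filter_upwards [self_mem_nhdsWithin] with a ha using ha.1
    have hderiv : ∀ s ∈ Set.Ico 0 t, HasDerivWithinAt
        (fun s => ((Real.exp (r * s) : ℝ) : 𝕜) * ⟪w, extendZero S s u⟫) 0 (Set.Ici s) s := by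
      intro s hs
      refine ((hexp s).hasDerivWithinAt.mul (hT s hs.1)).congr_deriv ?_
      push_cast
      ring
    have := constant_of_has_deriv_right_zero hcont hderiv t ⟨ht.le, le_rfl⟩
    simpa [extendZero_zero, extendZero_of_pos ht] using this
  refine ext_inner_left 𝕜 fun w => ?_
  rw [inner_smul_right, ← main w, ← mul_assoc, ← RCLike.ofReal_mul, ← Real.exp_add]
  simp

end Hilbert

/-! ### Eigenvectors and norms for symmetric semigroups -/

section SymmetricSemigroup

variable {𝕜 : Type*} [RCLike 𝕜] {H : Type*} [NormedAddCommGroup H] [InnerProductSpace 𝕜 H]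
  {S : ℝ → H →L[𝕜] H} {A : H →ₗ.[𝕜] H}

local notation "⟪" x ", " y "⟫" => inner 𝕜 x y

/-- A family of operators consists of symmetric operators for all positive times. -/
def IsSymmetricFamily (S : ℝ → H →L[𝕜] H) : Prop :=
  ∀ t : ℝ, 0 < t → ∀ u v : H, ⟪S t u, v⟫ = ⟪u, S t v⟫

theorem IsSemigroup.half_apply (hS : IsSemigroup S) {t : ℝ} (ht : 0 < t) (u : H) :
    S (t / 2) (S (t / 2) u) = S t u := by
  rw [← hS.add_apply (half_pos ht) (half_pos ht), add_halves]

theorem inner_semigroup_self (hS : IsSemigroup S) (hsym : IsSymmetricFamily S) {t : ℝ}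
    (ht : 0 < t) (u : H) : ⟪u, S t u⟫ = ((‖S (t / 2) u‖ ^ 2 : ℝ) : 𝕜) := by
  rw [← hS.half_apply ht, ← hsym _ (half_pos ht), inner_self_eq_norm_sq_to_K]
  norm_cast

theorem tendsto_div_two_pow {t : ℝ} (ht : 0 < t) :
    Tendsto (fun n : ℕ => t / 2 ^ n) atTop (𝓝[>] 0) := by
  refine tendsto_nhdsWithin_iff.2 ⟨?_, Eventually.of_forall fun n => Set.mem_Ioi.2 (by positivity)⟩
  exact tendsto_const_nhds.div_atTop (tendsto_pow_atTop_atTop_of_one_lt one_lt_two)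

/-- If `S_t u = 0`, then `‖S_{t/2} u‖ ^ 2 = ⟪u, S_t u⟫ = 0`, and so on for `t / 2 ^ n`, which tends
to `0`. -/
theorem semigroup_injective (hS : IsC0Semigroup S) (hsym : IsSymmetricFamily S) {t : ℝ}
    (ht : 0 < t) {u : H} (hu : S t u = 0) : u = 0 := by
  have h : ∀ n : ℕ, S (t / 2 ^ n) u = 0 := by
    intro n
    induction n with
    | zero => simpa using hu
    | succ n ih =>
      have h1 := inner_semigroup_self hS.isSemigroup hsym (t := t / 2 ^ n) (by positivity) u
      rw [ih, inner_zero_right, eq_comm, RCLike.ofReal_eq_zero, sq_eq_zero_iff, norm_eq_zero] at h1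
      rw [pow_succ, ← div_div, h1]
  refine tendsto_nhds_unique ((hS.tendsto_zero u).comp (tendsto_div_two_pow ht)) ?_
  exact tendsto_const_nhds.congr fun n => (h n).symm

theorem semigroup_half_apply_of_eigenvector (hS : IsSemigroup S) (hsym : IsSymmetricFamily S)
    {t c : ℝ} (ht : 0 < t) (hc : 0 < c) {u : H} (hu : S t u = (c : 𝕜) • u) :
    S (t / 2) u = ((√c : ℝ) : 𝕜) • u := by
  -- `g` lies in the kernel of `S_{t/2} + √c`, which is trivial as `S_{t/2} ≥ 0`
  set g := S (t / 2) u - ((√c : ℝ) : 𝕜) • u with hg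
  have e : S (t / 2) g + ((√c : ℝ) : 𝕜) • g = 0 := by
    rw [hg, map_sub, hS.half_apply ht, hu, map_smul, smul_sub, smul_smul, ← RCLike.ofReal_mul,
      Real.mul_self_sqrt hc.le]
    abel
  have e2 := congrArg (fun w => RCLike.re ⟪g, w⟫) e
  simp only [inner_add_right, inner_smul_right, inner_zero_right, map_zero, map_add,
    inner_semigroup_self hS hsym (half_pos ht) g, RCLike.ofReal_re, RCLike.re_ofReal_mul,
    inner_self_eq_norm_sq] at e2
  have h1 : 0 < √c := Real.sqrt_pos.2 hc
  have h2 : √c * ‖g‖ ^ 2 = 0 := by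
    nlinarith [sq_nonneg ‖S (t / 2 / 2) g‖, mul_nonneg h1.le (sq_nonneg ‖g‖)]
  have h3 : g = 0 := by simpa [h1.ne'] using h2
  exact sub_eq_zero.1 h3

theorem tendsto_natFloor_mul_two_pow_div {t : ℝ} (ht : 0 ≤ t) :
    Tendsto (fun n : ℕ => (⌊t * 2 ^ n⌋₊ : ℝ) / 2 ^ n) atTop (𝓝 t) :=
  (tendsto_nat_floor_mul_div_atTop ht).comp (tendsto_pow_atTop_atTop_of_one_lt one_lt_two)

/-- An eigenvector of `S_1` with positive eigenvalue is an eigenvector of all `S_t`. The formula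
holds for dyadic times, by taking square roots and powers, and it extends by continuity. -/
theorem semigroup_apply_of_apply_one [CompleteSpace H] (hS : IsC0Semigroup S)
    (hsym : IsSymmetricFamily S) {m : ℝ} (hm : 0 < m) {u : H} (hu : S 1 u = (m : 𝕜) • u) {t : ℝ}
    (ht : 0 < t) : S t u = ((m ^ t : ℝ) : 𝕜) • u := by
  have h1 : ∀ n : ℕ, S (1 / 2 ^ n) u = ((m ^ ((1 : ℝ) / 2 ^ n) : ℝ) : 𝕜) • u := by
    intro n
    induction n with
    | zero => simpa using hu
    | succ n ih =>
      have := semigroup_half_apply_of_eigenvector hS.isSemigroup hsym (by positivity)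
        (Real.rpow_pos_of_pos hm _) ih
      rw [Real.sqrt_eq_rpow, ← Real.rpow_mul hm.le, div_div, ← pow_succ, div_mul_div_comm, one_mul,
        ← pow_succ] at this
      exact this
  have h2 : ∀ n k : ℕ, extendZero S (k / 2 ^ n) u = ((m ^ ((k : ℝ) / 2 ^ n) : ℝ) : 𝕜) • u := by
    intro n k
    induction k with
    | zero => simp [extendZero_zero]
    | succ k ih =>
      have e : ((k + 1 : ℕ) : ℝ) / 2 ^ n = 1 / 2 ^ n + k / 2 ^ n := by push_cast; ring
      rw [e, hS.isSemigroup.extendZero_add (by positivity) (by positivity), ih, map_smul,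
        extendZero_of_pos (by positivity), h1, smul_smul, ← RCLike.ofReal_mul,
        Real.rpow_add hm, mul_comm]
  have h3 := hS.tendsto_extendZero_apply (x := u) ht.le (tendsto_natFloor_mul_two_pow_div ht.le)
    (Eventually.of_forall fun n => by positivity) tendsto_const_nhds
  rw [extendZero_of_pos ht] at h3
  refine tendsto_nhds_unique h3 (Tendsto.congr (fun n => (h2 n _).symm) ?_)
  refine Tendsto.smul_const ?_ u
  refine (RCLike.continuous_ofReal.tendsto _).comp ?_
  exact tendsto_const_nhds.rpow (tendsto_natFloor_mul_two_pow_div ht.le) (Or.inl hm.ne')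

theorem exists_pos_of_apply_one_eq_smul (hS : IsC0Semigroup S) (hsym : IsSymmetricFamily S)
    {z : 𝕜} {u : H} (hu0 : u ≠ 0) (hu : S 1 u = z • u) : ∃ m : ℝ, 0 < m ∧ z = m := by
  have h := inner_semigroup_self hS.isSemigroup hsym one_pos u
  rw [hu, inner_smul_right, inner_self_eq_norm_sq_to_K, ← RCLike.ofReal_pow] at h
  have hn : 0 < ‖u‖ := norm_pos_iff.2 hu0
  have hn' : ((‖u‖ ^ 2 : ℝ) : 𝕜) ≠ 0 := by
    rw [Ne, RCLike.ofReal_eq_zero]; positivity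
  have hS0 : 0 < ‖S (1 / 2) u‖ :=
    norm_pos_iff.2 fun h0 => hu0 (semigroup_injective hS hsym (by norm_num) h0)
  refine ⟨‖S (1 / 2) u‖ ^ 2 / ‖u‖ ^ 2, by positivity, ?_⟩
  rw [RCLike.ofReal_div, eq_div_iff hn', h]

theorem norm_semigroup_half_sq [CompleteSpace H] (hS : IsSemigroup S)
    (hsym : IsSymmetricFamily S) {t : ℝ} (ht : 0 < t) : ‖S (t / 2)‖ ^ 2 = ‖S t‖ := by
  have hsa : IsSelfAdjoint (S (t / 2)) :=
    ContinuousLinearMap.isSelfAdjoint_iff_isSymmetric.2 (hsym _ (half_pos ht))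
  have := CStarRing.norm_star_mul_self (x := S (t / 2))
  rw [hsa.star_eq] at this
  rw [sq, ← this, ContinuousLinearMap.mul_def, ← hS _ _ (half_pos ht) (half_pos ht), add_halves]

theorem norm_semigroup_pos [Nontrivial H] (hS : IsC0Semigroup S) (hsym : IsSymmetricFamily S)
    {t : ℝ} (ht : 0 < t) : 0 < ‖S t‖ := by
  obtain ⟨u, hu⟩ := exists_ne (0 : H)
  refine norm_pos_iff.2 fun h => hu (semigroup_injective hS hsym ht ?_)
  rw [h]; rfl

theorem norm_semigroup_one_div_two_pow [CompleteSpace H] (hS : IsSemigroup S)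
    (hsym : IsSymmetricFamily S) (n : ℕ) : ‖S (1 / 2 ^ n)‖ = ‖S 1‖ ^ ((1 : ℝ) / 2 ^ n) := by
  induction n with
  | zero => simp
  | succ n ih =>
    have := norm_semigroup_half_sq hS hsym (t := 1 / 2 ^ n) (by positivity)
    rw [ih, div_div, ← pow_succ] at this
    rw [← Real.sqrt_sq (norm_nonneg (S (1 / 2 ^ (n + 1)))), this, Real.sqrt_eq_rpow,
      ← Real.rpow_mul (norm_nonneg _), div_mul_div_comm, one_mul, ← pow_succ]

/-- The lower bound `-log ‖S_1‖` of the numerical range of `A`. -/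
theorem le_re_inner_of_mem_domain [CompleteSpace H] [Nontrivial H] (hS : IsC0Semigroup S)
    (hsym : IsSymmetricFamily S) (hA : generator S = -A) (u : A.domain) :
    -Real.log ‖S 1‖ * ‖(u : H)‖ ^ 2 ≤ RCLike.re ⟪(u : H), A u⟫ := by
  have hpos := norm_semigroup_pos hS hsym one_pos
  have h1 := RCLike.continuous_re.tendsto _ |>.comp ((tendsto_const_nhds (x := (u : H))).inner
    (𝕜 := 𝕜) ((tendsto_of_mem_domain hA u).comp (tendsto_div_two_pow one_pos)))
  -- the difference quotients along dyadic times are bounded by those of `t ↦ ‖S_1‖ ^ t`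
  have h2 : Tendsto (fun n : ℕ => (((1 : ℝ) / 2 ^ n)⁻¹ * (‖S 1‖ ^ ((1 : ℝ) / 2 ^ n) - 1))
      * ‖(u : H)‖ ^ 2) atTop (𝓝 (Real.log ‖S 1‖ * ‖(u : H)‖ ^ 2)) := by
    refine Tendsto.mul_const _ ?_
    have hd : HasDerivAt (fun x : ℝ => ‖S 1‖ ^ x) (Real.log ‖S 1‖) 0 := by
      simpa using Real.hasStrictDerivAt_const_rpow hpos 0 |>.hasDerivAt
    rw [hasDerivAt_iff_tendsto_slope_zero] at hd
    have := (hd.mono_left (nhdsWithin_mono _ fun x (hx : 0 < x) => hx.ne')).comp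
      (tendsto_div_two_pow one_pos)
    simpa [Function.comp_def] using this
  rw [inner_neg_right, map_neg] at h1
  have h3 := le_of_tendsto_of_tendsto' h1 h2 fun n => by
    have ht : (0 : ℝ) < 1 / 2 ^ n := by positivity
    simp only [Function.comp_apply, inner_smul_right, RCLike.re_ofReal_mul]
    rw [mul_assoc]
    refine mul_le_mul_of_nonneg_left ?_ (by positivity)
    rw [inner_sub_right, map_sub, inner_self_eq_norm_sq, sub_mul, one_mul,
      ← norm_semigroup_one_div_two_pow hS.isSemigroup hsym]
    refine sub_le_sub_right ?_ _
    calc RCLike.re ⟪(u : H), S (1 / 2 ^ n) u⟫ ≤ ‖(u : H)‖ * ‖S (1 / 2 ^ n) u‖ :=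
          re_inner_le_norm _ _
      _ ≤ ‖(u : H)‖ * (‖S (1 / 2 ^ n)‖ * ‖(u : H)‖) := by
          gcongr; exact ContinuousLinearMap.le_opNorm _ _
      _ = _ := by ring
  linarith

end SymmetricSemigroup

/-! ### The spectrum of a self-adjoint operator that is bounded below -/

section Resolvent

variable {𝕜 : Type*} [RCLike 𝕜] {H : Type*} [NormedAddCommGroup H] [InnerProductSpace 𝕜 H]
  {A : H →ₗ.[𝕜] H}

local notation "⟪" x ", " y "⟫" => inner 𝕜 x y

theorem IsEigenvector.mem_unboundedSpectrum {z : 𝕜} {u : H} (hu : IsEigenvector A z u) :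
    z ∈ unboundedSpectrum A := by
  rintro ⟨R, -, hR⟩
  obtain ⟨h0, hu, e⟩ := hu
  have := hR ⟨u, hu⟩
  rw [e, sub_self, map_zero] at this
  exact h0 this.symm

theorem norm_le_of_le_norm_inner {z : 𝕜} {c : ℝ} (u : A.domain)
    (h : c * ‖(u : H)‖ ^ 2 ≤ ‖⟪(u : H), z • (u : H) - A u⟫‖) :
    c * ‖(u : H)‖ ≤ ‖z • (u : H) - A u‖ := by
  rcases (norm_nonneg (u : H)).eq_or_lt with h0 | h0
  · rw [← h0, mul_zero]; exact norm_nonneg _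
  · have := h.trans (norm_inner_le_norm _ _)
    rw [sq, ← mul_assoc, mul_comm] at this
    exact le_of_mul_le_mul_left this h0

variable [CompleteSpace H]

/-- Maximality of a self-adjoint operator: its adjoint has no larger domain. -/
theorem mem_domain_of_forall_inner_eq (hsa : IsSelfAdjoint A) {y w : H}
    (h : ∀ x : A.domain, ⟪w, (x : H)⟫ = ⟪y, A x⟫) : ∃ hy : y ∈ A.domain, A ⟨y, hy⟩ = w := by
  have hd := hsa.dense_domain
  have hy : y ∈ A.adjoint.domain := LinearPMap.mem_adjoint_domain_of_exists y ⟨w, h⟩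
  have e : A.adjoint ⟨y, hy⟩ = w := LinearPMap.adjoint_apply_eq hd ⟨y, hy⟩ h
  have key : ∀ B : H →ₗ.[𝕜] H, B = A → ∀ hB : y ∈ B.domain, B ⟨y, hB⟩ = w →
      ∃ hy : y ∈ A.domain, A ⟨y, hy⟩ = w := by
    rintro _ rfl hB h
    exact ⟨hB, h⟩
  exact key _ (LinearPMap.isSelfAdjoint_def.1 hsa) hy e

/-- If `z - A` and `conj z - A` are bounded below, then `z` is in the resolvent set of the
self-adjoint operator `A`: the range of `z - A` is closed, as `A` is closed, and dense, as its
orthogonal complement is the kernel of `conj z - A`. -/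
theorem inResolventSet_of_bounded_below (hsa : IsSelfAdjoint A) {z : 𝕜} {c : ℝ} (hc : 0 < c)
    (h1 : ∀ u : A.domain, c * ‖(u : H)‖ ≤ ‖z • (u : H) - A u‖)
    (h2 : ∀ u : A.domain, c * ‖(u : H)‖ ≤ ‖(starRingEnd 𝕜) z • (u : H) - A u‖) :
    InResolventSet A z := by
  set B : A.domain →ₗ[𝕜] H := z • A.domain.subtype - A.toFun with hB
  have hBa : ∀ u : A.domain, B u = z • (u : H) - A u := fun u => rfl
  have hinj : LinearMap.ker B = ⊥ := by
    rw [LinearMap.ker_eq_bot']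
    intro u hu
    have := h1 u
    rw [← hBa, hu, norm_zero] at this
    have h0 : ‖(u : H)‖ = 0 := le_antisymm (by nlinarith [norm_nonneg (u : H)]) (norm_nonneg _)
    exact Subtype.ext (norm_eq_zero.1 h0)
  have hclosed : IsClosed (LinearMap.range B : Set H) := by
    refine IsSeqClosed.isClosed fun y l hy hl => ?_
    choose x hx using hy
    have hcau : CauchySeq fun n => (x n : H) := by
      rw [Metric.cauchySeq_iff']
      intro ε hε
      obtain ⟨N, hN⟩ := Metric.cauchySeq_iff'.1 hl.cauchySeq (c * ε) (by positivity)
      refine ⟨N, fun n hn => ?_⟩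
      have h3 := h1 (x n - x N)
      rw [← hBa, map_sub, hx, hx] at h3
      have h4 := hN n hn
      rw [dist_eq_norm] at h4 ⊢
      exact lt_of_mul_lt_mul_left (h3.trans_lt h4) hc.le
    obtain ⟨a, ha⟩ := cauchySeq_tendsto_of_complete hcau
    have hAx : Tendsto (fun n => A (x n)) atTop (𝓝 (z • a - l)) := by
      refine ((ha.const_smul z).sub hl).congr fun n => ?_
      rw [← hx n, hBa]; abel
    have hg : (a, z • a - l) ∈ A.graph :=
      IsClosed.mem_of_tendsto hsa.isClosed (ha.prodMk_nhds hAx)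
        (Eventually.of_forall fun n => A.mem_graph (x n))
    rw [LinearPMap.mem_graph_iff] at hg
    obtain ⟨b, hb1, hb2⟩ := hg
    refine ⟨b, ?_⟩
    rw [hBa, hb1, hb2]; simp
  have hperp : (LinearMap.range B)ᗮ = ⊥ := by
    rw [Submodule.eq_bot_iff]
    intro w hw
    have hw' : ∀ x : A.domain, ⟪(starRingEnd 𝕜) z • w, (x : H)⟫ = ⟪w, A x⟫ := by
      intro x
      have := (Submodule.mem_orthogonal' _ _).1 hw (B x) ⟨x, rfl⟩
      rw [hBa, inner_sub_right, inner_smul_right, sub_eq_zero] at this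
      rw [inner_smul_left, RCLike.conj_conj, this]
    obtain ⟨hwd, e⟩ := mem_domain_of_forall_inner_eq hsa hw'
    have := h2 ⟨w, hwd⟩
    rw [e, sub_self, norm_zero] at this
    exact norm_eq_zero.1 (le_antisymm (by nlinarith [norm_nonneg w]) (norm_nonneg _))
  have hsurj : LinearMap.range B = ⊤ := by
    rw [← hclosed.submodule_topologicalClosure_eq]
    exact (Submodule.topologicalClosure_eq_top_iff).2 hperp
  set e : A.domain ≃ₗ[𝕜] H := LinearEquiv.ofBijective B
    ⟨LinearMap.ker_eq_bot.1 hinj, LinearMap.range_eq_top.1 hsurj⟩ with he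
  have hBe : ∀ u, B (e.symm u) = u := fun u => e.apply_symm_apply u
  refine ⟨(A.domain.subtype ∘ₗ e.symm.toLinearMap).mkContinuous c⁻¹ fun u => ?_, fun u => ?_,
    fun u => ?_⟩
  · rw [inv_mul_eq_div, le_div_iff₀ hc, mul_comm]
    have := h1 (e.symm u)
    rwa [← hBa, hBe] at this
  · exact ⟨(e.symm u).2, hBe u⟩
  · exact congrArg Subtype.val (e.symm_apply_apply u)

/-- The spectrum of a self-adjoint operator with lower bound `r` is contained in `[r, ∞)`. -/
theorem le_of_mem_unboundedSpectrum (hsa : IsSelfAdjoint A) {r : ℝ}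
    (hr : ∀ u : A.domain, r * ‖(u : H)‖ ^ 2 ≤ RCLike.re ⟪(u : H), A u⟫) {z : 𝕜}
    (hz : z ∈ unboundedSpectrum A) : (r : 𝕜) ≤ z := by
  by_contra hle
  refine hz ?_
  have him : ∀ u : A.domain, RCLike.im ⟪(u : H), A u⟫ = 0 := by
    intro u
    have h := inner_apply_eq_of_isSelfAdjoint hsa u u
    rw [← inner_conj_symm] at h
    exact RCLike.conj_eq_iff_im.1 h
  have hin : ∀ (w : 𝕜) (u : A.domain), ⟪(u : H), w • (u : H) - A u⟫
      = w * ((‖(u : H)‖ ^ 2 : ℝ) : 𝕜) - ⟪(u : H), A u⟫ := by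
    intro w u
    rw [inner_sub_right, inner_smul_right, inner_self_eq_norm_sq_to_K, RCLike.ofReal_pow]
  rw [RCLike.le_iff_re_im, RCLike.ofReal_re, RCLike.ofReal_im] at hle
  by_cases h : RCLike.im z = 0
  · have hlt : RCLike.re z < r := by
      by_contra h'
      exact hle ⟨not_lt.1 h', h.symm⟩
    have main : ∀ w : 𝕜, RCLike.re w = RCLike.re z → ∀ u : A.domain,
        (r - RCLike.re z) * ‖(u : H)‖ ≤ ‖w • (u : H) - A u‖ := by
      intro w hw u
      refine norm_le_of_le_norm_inner u ?_
      refine le_trans ?_ ((neg_le_abs _).trans (RCLike.abs_re_le_norm _))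
      rw [hin, map_sub, RCLike.re_mul_ofReal, hw]
      linarith [hr u]
    exact inResolventSet_of_bounded_below hsa (sub_pos.2 hlt) (main z rfl)
      (main _ (RCLike.conj_re z))
  · have main : ∀ w : 𝕜, |RCLike.im w| = |RCLike.im z| → ∀ u : A.domain,
        |RCLike.im z| * ‖(u : H)‖ ≤ ‖w • (u : H) - A u‖ := by
      intro w hw u
      refine norm_le_of_le_norm_inner u ?_
      refine le_trans ?_ (RCLike.abs_im_le_norm _)
      rw [hin, map_sub, him, RCLike.im_mul_ofReal, sub_zero, abs_mul, hw, abs_of_nonneg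
        (sq_nonneg ‖(u : H)‖)]
    exact inResolventSet_of_bounded_below hsa (abs_pos.2 h) (main z rfl)
      (main _ (by rw [RCLike.conj_im, abs_neg]))

end Resolvent

/-! ### The least spectral value and eigenvector expansions -/

section Eigenbasis

universe u

variable {𝕜 : Type u} [RCLike 𝕜] {H : Type*} [NormedAddCommGroup H] [InnerProductSpace 𝕜 H]
  [CompleteSpace H] {S : ℝ → H →L[𝕜] H} {A : H →ₗ.[𝕜] H}

local notation "⟪" x ", " y "⟫" => inner 𝕜 x y

/-- A maximising eigenvector of `S_1` is an eigenvector of `A` for the least spectral value. -/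
theorem isLeast_unboundedSpectrum [Nontrivial H] (hS : IsC0Semigroup S)
    (hA : generator S = -A) (hsa : IsSelfAdjoint A) {u : H} (hu0 : u ≠ 0)
    (hu : S 1 u = ((‖S 1‖ : ℝ) : 𝕜) • u) :
    IsLeast (unboundedSpectrum A) ((-Real.log ‖S 1‖ : ℝ) : 𝕜) ∧
      IsEigenvector A ((-Real.log ‖S 1‖ : ℝ) : 𝕜) u := by
  have hsym : IsSymmetricFamily S := fun t ht => inner_semigroup_eq hS hA hsa ht
  have hpos := norm_semigroup_pos hS hsym one_pos
  have hev : IsEigenvector A ((-Real.log ‖S 1‖ : ℝ) : 𝕜) u := by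
    have hd : HasDerivAt (fun x : ℝ => ‖S 1‖ ^ x) (Real.log ‖S 1‖) 0 := by
      simpa using Real.hasStrictDerivAt_const_rpow hpos 0 |>.hasDerivAt
    rw [hasDerivAt_iff_tendsto_slope_zero] at hd
    have h1 := ((RCLike.continuous_ofReal (K := 𝕜)).tendsto _).comp
      (hd.mono_left (nhdsWithin_mono _ fun x (hx : 0 < x) => hx.ne'))
    obtain ⟨hu', e⟩ := exists_mem_domain_of_tendsto hA (u := u) ((h1.smul_const u).congr' (by
      filter_upwards [self_mem_nhdsWithin] with t ht
      rw [semigroup_apply_of_apply_one hS hsym hpos hu ht]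
      simp only [Function.comp_apply, zero_add, Real.rpow_zero, smul_eq_mul, RCLike.ofReal_mul,
        RCLike.ofReal_sub, RCLike.ofReal_one, sub_smul, mul_smul, one_smul]))
    exact ⟨hu0, hu', by rw [e, RCLike.ofReal_neg, neg_smul]⟩
  exact ⟨⟨hev.mem_unboundedSpectrum, fun z hz => le_of_mem_unboundedSpectrum hsa
    (le_re_inner_of_mem_domain hS hsym hA) hz⟩, hev⟩

/-- If `S_1` is compact, then there is a Hilbert basis of joint eigenvectors of all `S_t`. -/
theorem exists_hilbertBasis_semigroup (hS : IsC0Semigroup S) (hsym : IsSymmetricFamily S)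
    (hcomp : IsCompactOperator (S 1)) :
    ∃ (ι : Type u) (b : HilbertBasis ι 𝕜 H) (m : ι → ℝ), (∀ i, 0 < m i) ∧
      ∀ i, ∀ t, 0 < t → S t (b i) = ((m i ^ t : ℝ) : 𝕜) • b i := by
  have hsym1 : (S 1 : H →ₗ[𝕜] H).IsSymmetric := hsym 1 one_pos
  have hfin : ∀ z : 𝕜, FiniteDimensional 𝕜 (Module.End.eigenspace (S 1 : H →ₗ[𝕜] H) z) := by
    intro z
    by_cases hz : z = 0
    · have : Module.End.eigenspace (S 1 : H →ₗ[𝕜] H) z = ⊥ := by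
        rw [Submodule.eq_bot_iff]
        intro u hu
        rw [Module.End.mem_eigenspace_iff, hz, zero_smul] at hu
        exact semigroup_injective hS hsym one_pos hu
      rw [this]; infer_instance
    · exact ContinuousLinearMap.finite_dimensional_eigenspace hcomp z hz
  have hortho := hsym1.orthogonalFamily_eigenspaces.orthonormal_sigma_orthonormal
    (v_family := fun z => stdOrthonormalBasis 𝕜 (Module.End.eigenspace (S 1 : H →ₗ[𝕜] H) z))
    (fun z => (stdOrthonormalBasis 𝕜 _).orthonormal)
  suffices hbot : _ by
    set b := HilbertBasis.mkOfOrthogonalEqBot hortho hbot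
    have hb : ∀ i, S 1 (b i) = i.1 • b i := by
      intro i
      have : b i = _ := congrFun (HilbertBasis.coe_mkOfOrthogonalEqBot hortho hbot) i
      rw [this]
      exact Module.End.mem_eigenspace_iff.1 (stdOrthonormalBasis 𝕜
        (Module.End.eigenspace (S 1 : H →ₗ[𝕜] H) i.1) i.2).2
    choose m hm hm' using fun i => exists_pos_of_apply_one_eq_smul hS hsym
      (b.orthonormal.ne_zero i) (hb i)
    exact ⟨_, b, m, hm, fun i t ht => semigroup_apply_of_apply_one hS hsym (hm i)
      ((hb i).trans (by rw [hm' i])) ht⟩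
  rw [Submodule.eq_bot_iff]
  intro v hv
  have hv' : v ∈ (⨆ z, Module.End.eigenspace (S 1 : H →ₗ[𝕜] H) z)ᗮ := by
    rw [← Submodule.iInf_orthogonal, Submodule.mem_iInf]
    intro z
    rw [Submodule.mem_orthogonal]
    intro w hw
    have e := congrArg Subtype.val ((stdOrthonormalBasis 𝕜
      (Module.End.eigenspace (S 1 : H →ₗ[𝕜] H) z)).sum_repr ⟨w, hw⟩)
    rw [Submodule.coe_sum] at e
    rw [← show _ = w from e, sum_inner]
    refine Finset.sum_eq_zero fun i _ => ?_
    rw [Submodule.coe_smul, inner_smul_left]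
    have := (Submodule.mem_orthogonal _ _).1 hv _ (Submodule.subset_span ⟨⟨z, i⟩, rfl⟩)
    exact mul_eq_zero_of_right _ this
  rw [ContinuousLinearMap.orthogonalComplement_iSup_eigenspaces_eq_bot hcomp hsym1] at hv'
  exact hv'

/-- The functions `s ↦ ⟪g, S_s h⟫` are real analytic, by expansion into eigenvectors, and so they
vanish if they vanish on some interval `(0, t]`. -/
theorem re_inner_semigroup_eq_zero (hS : IsC0Semigroup S) (hsym : IsSymmetricFamily S)
    (hcomp : IsCompactOperator (S 1)) {t : ℝ} (ht : 0 < t) {g h : H}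
    (hz : ∀ s, 0 < s → s ≤ t → RCLike.re ⟪g, S s h⟫ = 0) {s : ℝ} (hs : 0 < s) :
    RCLike.re ⟪g, S s h⟫ = 0 := by
  obtain ⟨ι, b, m, hm, hb⟩ := exists_hilbertBasis_semigroup hS hsym hcomp
  have hm1 : ∀ i, m i ≤ ‖S 1‖ := by
    intro i
    have h1 := (S 1).le_opNorm (b i)
    rwa [hb i 1 one_pos, Real.rpow_one, norm_smul, b.orthonormal.1 i, mul_one, mul_one,
      RCLike.norm_ofReal, abs_of_pos (hm i)] at h1
  set c : ι → ℝ := fun i => RCLike.re (⟪g, b i⟫ * ⟪b i, h⟫) with hc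
  set F : ℂ → ℂ := fun w => ∑' i, (c i : ℂ) * (m i : ℂ) ^ w with hF
  have hFs : ∀ r : ℝ, 0 < r → F r = ((RCLike.re ⟪g, S r h⟫ : ℝ) : ℂ) := by
    intro r hr
    have h1 := (b.hasSum_inner_mul_inner g (S r h)).mapL (RCLike.reCLM : 𝕜 →L[ℝ] ℝ)
    have h2 := h1.mapL Complex.ofRealCLM
    refine (h2.congr_fun ?_).tsum_eq
    intro i
    have e : ⟪b i, S r h⟫ = ((m i ^ r : ℝ) : 𝕜) * ⟪b i, h⟫ := by
      rw [← hsym r hr, hb i r hr, inner_smul_left, RCLike.conj_ofReal]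
    rw [e, mul_left_comm]
    simp only [RCLike.reCLM_apply, RCLike.re_ofReal_mul, Complex.ofRealCLM_apply, hc]
    rw [mul_comm, Complex.ofReal_mul, Complex.ofReal_cpow (hm i).le]
  -- on this strip the series converges uniformly, and it contains `s` and `(0, t]`
  set R : ℝ := s + t with hR
  set U : Set ℂ := {w | 0 < w.re} ∩ {w | w.re < R} with hU
  have hUo : IsOpen U := (isOpen_lt continuous_const Complex.continuous_re).inter
    (isOpen_lt Complex.continuous_re continuous_const)
  have hUc : Convex ℝ U := (convex_halfSpace_re_gt 0).inter (convex_halfSpace_re_lt R)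
  have hdiff : DifferentiableOn ℂ F U := by
    refine Complex.differentiableOn_tsum_of_summable_norm
      (u := fun i => ‖⟪g, b i⟫ * ⟪b i, h⟫‖ * max 1 ‖S 1‖ ^ R) ?_ ?_ hUo ?_
    · exact (b.summable_inner_mul_inner g h).norm.mul_right _
    · intro i w hw
      refine DifferentiableAt.differentiableWithinAt ?_
      refine (differentiableAt_const _).mul (differentiableAt_id.const_cpow (Or.inl ?_))
      exact_mod_cast (hm i).ne'
    · intro i w hw
      rw [norm_mul, Complex.norm_cpow_eq_rpow_re_of_pos (hm i), Complex.norm_real]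
      refine mul_le_mul (RCLike.abs_re_le_norm _) ?_ (Real.rpow_nonneg (hm i).le _) (norm_nonneg _)
      calc m i ^ w.re ≤ max 1 ‖S 1‖ ^ w.re :=
          Real.rpow_le_rpow (hm i).le ((hm1 i).trans (le_max_right _ _)) hw.1.le
        _ ≤ max 1 ‖S 1‖ ^ R := Real.rpow_le_rpow_of_exponent_le (le_max_left _ _) hw.2.le
  have han : AnalyticOnNhd ℂ F U := hdiff.analyticOnNhd hUo
  have hmem : ∀ r : ℝ, 0 < r → r < R → (r : ℂ) ∈ U := fun r h1 h2 => ⟨by simpa, by simpa⟩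
  have hz0 : Set.EqOn F 0 U := by
    refine han.eqOn_zero_of_preconnected_of_frequently_eq_zero hUc.isPreconnected
      (hmem (t / 2) (half_pos ht) (by linarith)) ?_
    -- zeros of `F` that accumulate at `t / 2`
    have hseq : Tendsto (fun n : ℕ => ((t / 2 + t / 2 / 2 ^ (n + 1) : ℝ) : ℂ)) atTop
        (𝓝[≠] ((t / 2 : ℝ) : ℂ)) := by
      refine tendsto_nhdsWithin_iff.2 ⟨?_, Eventually.of_forall fun n => ?_⟩
      · refine (Complex.continuous_ofReal.tendsto _).comp ?_
        have h1 := ((tendsto_div_two_pow (half_pos ht)).mono_right nhdsWithin_le_nhds).comp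
          (tendsto_add_atTop_nat 1)
        simpa using h1.const_add (t / 2)
      · have : (0 : ℝ) < t / 2 / 2 ^ (n + 1) := by positivity
        simp only [Set.mem_compl_iff, Set.mem_singleton_iff, Complex.ofReal_inj]
        linarith
    refine hseq.frequently (Eventually.frequently (Eventually.of_forall fun n => ?_))
    have h1 : (0 : ℝ) < t / 2 / 2 ^ (n + 1) := by positivity
    have h2 : t / 2 / 2 ^ (n + 1) ≤ t / 2 :=
      div_le_self (half_pos ht).le (one_le_pow₀ one_le_two)
    rw [hFs _ (by linarith), hz _ (by linarith) (by linarith), Complex.ofReal_zero]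
  have := hz0 (hmem s hs (by linarith))
  rw [hFs s hs] at this
  exact Complex.ofReal_eq_zero.1 this

end Eigenbasis

/-! ### Operators from `L_2(K)` to `C(K)` -/

section Modulus

variable {𝕜 : Type*} [RCLike 𝕜] {K : Type*} [MeasurableSpace K] {μ : Measure K}

/-- The modulus `|f|` of an `L_2`-function. -/
def absLp (f : Lp 𝕜 2 μ) : Lp 𝕜 2 μ :=
  ((Lp.memLp f).norm.ofReal (K := 𝕜)).toLp

theorem coeFn_absLp (f : Lp 𝕜 2 μ) : absLp f =ᵐ[μ] fun x => ((‖f x‖ : ℝ) : 𝕜) :=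
  MemLp.coeFn_toLp _

theorem absLp_nonneg (f : Lp 𝕜 2 μ) : ∀ᵐ x ∂μ, 0 ≤ absLp f x := by
  filter_upwards [coeFn_absLp f] with x hx
  rw [hx, RCLike.ofReal_nonneg]
  exact norm_nonneg _

theorem norm_absLp (f : Lp 𝕜 2 μ) : ‖absLp f‖ = ‖f‖ := by
  have h : ∀ᵐ x ∂μ, ‖absLp f x‖ = ‖f x‖ := by
    filter_upwards [coeFn_absLp f] with x hx
    rw [hx, RCLike.norm_ofReal, abs_norm]
  exact le_antisymm (Lp.norm_le_norm_of_ae_le (h.mono fun x hx => hx.le))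
    (Lp.norm_le_norm_of_ae_le (h.mono fun x hx => hx.ge))

/-- The cone of nonnegative functions in `L_2` is self-dual. -/
theorem ae_nonneg_of_forall_inner_nonneg [IsFiniteMeasure μ] {k : Lp 𝕜 2 μ}
    (h : ∀ f : Lp 𝕜 2 μ, (∀ᵐ x ∂μ, 0 ≤ f x) → 0 ≤ inner 𝕜 k f) : ∀ᵐ x ∂μ, 0 ≤ k x := by
  have hint : Integrable k μ := (Lp.memLp k).integrable (by norm_num)
  have hs : ∀ s, MeasurableSet s → μ s < ⊤ → 0 ≤ ∫ x in s, k x ∂μ := by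
    intro s hs hμs
    have h0 : ∀ᵐ x ∂μ, 0 ≤ indicatorConstLp 2 hs hμs.ne (1 : 𝕜) x := by
      filter_upwards [indicatorConstLp_coeFn (p := 2) (hs := hs) (hμs := hμs.ne) (c := (1 : 𝕜))]
        with x hx
      rw [hx]
      exact Set.indicator_nonneg (fun _ _ => zero_le_one) x
    have h1 := h _ h0
    rw [← inner_conj_symm, RCLike.nonneg_iff, RCLike.conj_re, RCLike.conj_im, neg_eq_zero] at h1
    rw [← L2.inner_indicatorConstLp_one hs hμs.ne, RCLike.nonneg_iff]
    exact h1
  have hre : 0 ≤ᵐ[μ] fun x => RCLike.re (k x) := by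
    refine ae_nonneg_of_forall_setIntegral_nonneg hint.re fun s hms hμs => ?_
    rw [integral_re hint.integrableOn]
    exact (RCLike.nonneg_iff.1 (hs s hms hμs)).1
  have him : (fun x => RCLike.im (k x)) =ᵐ[μ] 0 := by
    refine Integrable.ae_eq_zero_of_forall_setIntegral_eq_zero hint.im fun s hms hμs => ?_
    rw [integral_im hint.integrableOn]
    exact (RCLike.nonneg_iff.1 (hs s hms hμs)).2
  filter_upwards [hre, him] with x h1 h2
  exact RCLike.nonneg_iff.2 ⟨h1, h2⟩

end Modulus

section Smoothing

variable {𝕜 : Type*} [RCLike 𝕜] {K : Type*} [MetricSpace K]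

theorem isClosed_setOf_nonneg (g : C(K, 𝕜)) : IsClosed {x | 0 ≤ g x} := by
  have e : {x | 0 ≤ g x} = {x | 0 ≤ RCLike.re (g x)} ∩ {x | RCLike.im (g x) = 0} :=
    Set.ext fun x => RCLike.nonneg_iff
  rw [e]
  exact (isClosed_le continuous_const (RCLike.continuous_re.comp g.continuous)).inter
    (isClosed_eq (RCLike.continuous_im.comp g.continuous) continuous_const)

theorem nonneg_of_ae_nonneg [MeasurableSpace K] {μ : Measure K}
    [μ.IsOpenPosMeasure] {g : C(K, 𝕜)} (h : ∀ᵐ x ∂μ, 0 ≤ g x) (x : K) : 0 ≤ g x := by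
  have := (isClosed_setOf_nonneg g).isOpen_compl.eq_empty_of_measure_zero (μ := μ) h
  by_contra hx
  have hx' : x ∈ {x | 0 ≤ g x}ᶜ := hx
  rw [this] at hx'
  exact hx'

variable [CompactSpace K] [MeasurableSpace K] [BorelSpace K] {μ : Measure K} [IsFiniteMeasure μ]
  [μ.IsOpenPosMeasure] {T : Lp 𝕜 2 μ →L[𝕜] Lp 𝕜 2 μ}

/-- Two nonnegative continuous functions that are orthogonal in `L_2` have disjoint supports. -/
theorem mul_eq_zero_of_inner_toLp_eq_zero {a b : C(K, 𝕜)} (ha : ∀ x, 0 ≤ a x) (hb : ∀ x, 0 ≤ b x)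
    (h : inner 𝕜 (ContinuousMap.toLp 2 μ 𝕜 a) (ContinuousMap.toLp 2 μ 𝕜 b) = 0) (x : K) :
    a x = 0 ∨ b x = 0 := by
  have hre : ∀ {z : 𝕜}, 0 ≤ z → z = (RCLike.re z : 𝕜) := fun hz =>
    RCLike.ext (by simp) (by simp [(RCLike.nonneg_iff.1 hz).2])
  rw [ContinuousMap.inner_toLp] at h
  have e : ∀ y, b y * (starRingEnd 𝕜) (a y)
      = ((RCLike.re (b y) * RCLike.re (a y) : ℝ) : 𝕜) := by
    intro y
    conv_lhs => rw [hre (ha y), hre (hb y), RCLike.conj_ofReal, ← RCLike.ofReal_mul]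
  simp only [e] at h
  rw [integral_ofReal, RCLike.ofReal_eq_zero] at h
  have hcont : Continuous fun y => RCLike.re (b y) * RCLike.re (a y) := by fun_prop
  have h2 := (integral_eq_zero_iff_of_nonneg (fun y => mul_nonneg (RCLike.nonneg_iff.1 (hb y)).1
    (RCLike.nonneg_iff.1 (ha y)).1) (hcont.integrable_of_hasCompactSupport
      (HasCompactSupport.of_compactSpace _))).1 h
  have h3 := congrFun ((hcont.ae_eq_iff_eq μ continuous_const).1 h2) x
  rcases mul_eq_zero.1 h3 with h4 | h4
  · right; rw [hre (hb x), h4, RCLike.ofReal_zero]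
  · left; rw [hre (ha x), h4, RCLike.ofReal_zero]

/-- An operator `T` on `L_2(K, μ)` with `T L_2(K) ⊆ C(K)`, as an operator from `L_2(K, μ)` to
`C(K)`. It is bounded by the closed graph theorem. -/
def smoothing (hT : MapsToC T) : Lp 𝕜 2 μ →L[𝕜] C(K, 𝕜) :=
  ContinuousLinearMap.ofSeqClosedGraph
    (g :=
      { toFun := fun f => (hT f).choose
        map_add' := fun f g => by
          apply ContinuousMap.toLp_injective (p := 2) (𝕜 := 𝕜) μ
          rw [(hT _).choose_spec, map_add, map_add, (hT _).choose_spec, (hT _).choose_spec]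
        map_smul' := fun c f => by
          apply ContinuousMap.toLp_injective (p := 2) (𝕜 := 𝕜) μ
          rw [(hT _).choose_spec, RingHom.id_apply, map_smul, map_smul, (hT _).choose_spec] })
    (by
      intro u x y hu hy
      apply ContinuousMap.toLp_injective (p := 2) (𝕜 := 𝕜) μ
      have h1 := ((ContinuousMap.toLp (E := 𝕜) 2 μ 𝕜).continuous.tendsto y).comp hy
      have h2 := (T.continuous.tendsto x).comp hu
      refine (tendsto_nhds_unique h1 (h2.congr fun n => ?_)).trans ?_
      · exact ((hT (u n)).choose_spec).symm
      · exact ((hT x).choose_spec).symm)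

theorem toLp_smoothing (hT : MapsToC T) (f : Lp 𝕜 2 μ) :
    ContinuousMap.toLp 2 μ 𝕜 (smoothing hT f) = T f :=
  (hT f).choose_spec

theorem coeFn_smoothing (hT : MapsToC T) (f : Lp 𝕜 2 μ) : T f =ᵐ[μ] smoothing hT f := by
  rw [← toLp_smoothing hT]
  exact ContinuousMap.coeFn_toLp μ _

/-- The function `k_x` in `L_2(K, μ)` such that `(T f)(x) = ⟪k_x, f⟫` for all `f`; that is, the
conjugate of the integral kernel of `T` at `x`. -/
def kernelAt (hT : MapsToC T) (x : K) : Lp 𝕜 2 μ :=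
  (InnerProductSpace.toDual 𝕜 (Lp 𝕜 2 μ)).symm
    ((ContinuousMap.evalCLM 𝕜 x).comp (smoothing hT))

theorem smoothing_apply_eq_inner (hT : MapsToC T) (f : Lp 𝕜 2 μ) (x : K) :
    smoothing hT f x = inner 𝕜 (kernelAt hT x) f := by
  rw [kernelAt, InnerProductSpace.toDual_symm_apply]; rfl

theorem smoothing_nonneg (hT : MapsToC T)
    (hpos : ∀ f : Lp 𝕜 2 μ, (∀ᵐ x ∂μ, 0 ≤ f x) → ∀ᵐ x ∂μ, 0 ≤ T f x) {f : Lp 𝕜 2 μ}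
    (hf : ∀ᵐ x ∂μ, 0 ≤ f x) (x : K) : 0 ≤ smoothing hT f x := by
  refine nonneg_of_ae_nonneg (μ := μ) ?_ x
  filter_upwards [coeFn_smoothing hT f, hpos f hf] with y h1 h2
  rwa [← h1]

theorem kernelAt_nonneg (hT : MapsToC T)
    (hpos : ∀ f : Lp 𝕜 2 μ, (∀ᵐ x ∂μ, 0 ≤ f x) → ∀ᵐ x ∂μ, 0 ≤ T f x) (x : K) :
    ∀ᵐ y ∂μ, 0 ≤ kernelAt hT x y := by
  refine ae_nonneg_of_forall_inner_nonneg fun f hf => ?_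
  rw [← smoothing_apply_eq_inner]
  exact smoothing_nonneg hT hpos hf x

/-- A positive operator satisfies `|T f| ≤ T |f|`. -/
theorem norm_smoothing_le (hT : MapsToC T)
    (hpos : ∀ f : Lp 𝕜 2 μ, (∀ᵐ x ∂μ, 0 ≤ f x) → ∀ᵐ x ∂μ, 0 ≤ T f x) (f : Lp 𝕜 2 μ) (x : K) :
    ‖smoothing hT f x‖ ≤ ‖smoothing hT (absLp f) x‖ := by
  set k := kernelAt hT x with hk
  -- as `k ≥ 0`, the integral of `conj k * |f|` is that of `|conj k * f|`
  have e : inner 𝕜 k (absLp f) = ((∫ y, ‖(inner 𝕜 (k y) (f y) : 𝕜)‖ ∂μ : ℝ) : 𝕜) := by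
    rw [L2.inner_def, ← integral_ofReal]
    refine integral_congr_ae ?_
    filter_upwards [coeFn_absLp f, kernelAt_nonneg hT hpos x] with y h1 h2
    have h3 : k y = ((‖k y‖ : ℝ) : 𝕜) := (RCLike.norm_of_nonneg' h2).symm
    rw [h1, RCLike.inner_apply, RCLike.inner_apply, norm_mul, RCLike.norm_conj]
    conv_lhs => rw [h3, RCLike.conj_ofReal, ← RCLike.ofReal_mul]
  rw [smoothing_apply_eq_inner, smoothing_apply_eq_inner, e, L2.inner_def, RCLike.norm_ofReal]
  exact (norm_integral_le_integral_norm _).trans (le_abs_self _)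

theorem norm_apply_le_norm_apply_absLp (hT : MapsToC T)
    (hpos : ∀ f : Lp 𝕜 2 μ, (∀ᵐ x ∂μ, 0 ≤ f x) → ∀ᵐ x ∂μ, 0 ≤ T f x) (f : Lp 𝕜 2 μ) :
    ‖T f‖ ≤ ‖T (absLp f)‖ := by
  refine Lp.norm_le_norm_of_ae_le ?_
  filter_upwards [coeFn_smoothing hT f, coeFn_smoothing hT (absLp f)] with x h1 h2
  rw [h1, h2]
  exact norm_smoothing_le hT hpos f x

/-- A bounded sequence in `L_2` has a weakly convergent subsequence; `T` maps it to a sequence of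
uniformly bounded functions that converges pointwise, and hence in `L_2`. -/
theorem isCompact_image_closedBall (hT : MapsToC T) :
    IsCompact (T '' Metric.closedBall 0 1) := by
  have : Fact ((2 : ENNReal) ≠ ⊤) := ⟨by simp⟩
  have : SecondCountableTopology (Lp 𝕜 2 μ) := Lp.SecondCountableTopology
  refine IsSeqCompact.isCompact fun y hy => ?_
  choose f hf hfy using hy
  obtain ⟨l, hl, φ, hφ, hlim⟩ := WeakDual.isSeqCompact_closedBall 𝕜 (Lp 𝕜 2 μ) 0 1
    (x := fun n => StrongDual.toWeakDual (InnerProductSpace.toDual 𝕜 (Lp 𝕜 2 μ) (f n)))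
    (fun n => by
      have := hf n
      rw [mem_closedBall_zero_iff] at this
      simpa using this)
  set g := (InnerProductSpace.toDual 𝕜 (Lp 𝕜 2 μ)).symm (WeakDual.toStrongDual l) with hg
  have hg1 : g ∈ Metric.closedBall (0 : Lp 𝕜 2 μ) 1 := by
    have : WeakDual.toStrongDual l ∈ Metric.closedBall (0 : StrongDual 𝕜 (Lp 𝕜 2 μ)) 1 := hl
    rw [mem_closedBall_zero_iff] at this ⊢
    rwa [hg, LinearIsometryEquiv.norm_map]
  refine ⟨T g, ⟨g, hg1, rfl⟩, φ, hφ, ?_⟩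
  have hpt : ∀ x, Tendsto (fun n => smoothing hT (f (φ n) - g) x) atTop (𝓝 0) := by
    intro x
    have h1 : Tendsto (fun n => inner 𝕜 (f (φ n)) (kernelAt hT x)) atTop
        (𝓝 (inner 𝕜 g (kernelAt hT x))) := by
      rw [hg, InnerProductSpace.toDual_symm_apply]
      exact ((WeakDual.eval_continuous (kernelAt hT x)).tendsto _).comp hlim
    have h2 := ((RCLike.continuous_conj (K := 𝕜)).tendsto _).comp h1
    have h3 := h2.sub_const ((starRingEnd 𝕜) (inner 𝕜 g (kernelAt hT x)))
    rw [sub_self] at h3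
    refine h3.congr fun n => ?_
    rw [smoothing_apply_eq_inner, inner_sub_right, Function.comp_apply, inner_conj_symm,
      inner_conj_symm]
  have hbd : ∀ n x, ‖smoothing hT (f (φ n) - g) x‖ ≤ ‖smoothing hT‖ * 2 := by
    intro n x
    refine (ContinuousMap.norm_coe_le_norm _ x).trans
      ((smoothing hT).le_of_opNorm_le_of_le le_rfl ?_)
    have h1 := hf (φ n)
    rw [mem_closedBall_zero_iff] at h1 hg1
    linarith [norm_sub_le (f (φ n)) g]
  have hint : Tendsto (fun n => ∫ x, smoothing hT (f (φ n) - g) x *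
      (starRingEnd 𝕜) (smoothing hT (f (φ n) - g) x) ∂μ) atTop (𝓝 0) := by
    have := tendsto_integral_of_dominated_convergence (μ := μ)
      (F := fun n x => smoothing hT (f (φ n) - g) x *
        (starRingEnd 𝕜) (smoothing hT (f (φ n) - g) x)) (f := fun _ => (0 : 𝕜))
      (fun _ => (‖smoothing hT‖ * 2) * (‖smoothing hT‖ * 2))
      (fun n => ((smoothing hT _).continuous.mul (RCLike.continuous_conj.comp
        (smoothing hT _).continuous)).aestronglyMeasurable) (integrable_const _)
      (fun n => Eventually.of_forall fun x => by
        rw [norm_mul, RCLike.norm_conj]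
        exact mul_le_mul (hbd n x) (hbd n x) (norm_nonneg _) (by positivity))
      (Eventually.of_forall fun x => by
        have := (hpt x).mul (((RCLike.continuous_conj (K := 𝕜)).tendsto _).comp (hpt x))
        simpa using this)
    simpa using this
  rw [tendsto_iff_norm_sub_tendsto_zero]
  have hsq : Tendsto (fun n => ‖y (φ n) - T g‖ ^ 2) atTop (𝓝 0) := by
    have h1 := (RCLike.continuous_re.tendsto _).comp hint
    rw [map_zero] at h1
    refine h1.congr fun n => ?_
    rw [Function.comp_apply, ← ContinuousMap.inner_toLp, toLp_smoothing, inner_self_eq_norm_sq,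
      map_sub, hfy]
  have := hsq.sqrt
  simpa using this

theorem isCompactOperator_of_mapsToC (hT : MapsToC T) : IsCompactOperator T :=
  (isCompactOperator_iff_image_closedBall_subset_compact (T : Lp 𝕜 2 μ →ₗ[𝕜] Lp 𝕜 2 μ)
    one_pos).2 ⟨_, isCompact_image_closedBall hT, subset_rfl⟩

/-- The norm of a positive smoothing operator is attained at a nonnegative function. -/
theorem exists_nonneg_norm_apply_eq (hT : MapsToC T)
    (hpos : ∀ f : Lp 𝕜 2 μ, (∀ᵐ x ∂μ, 0 ≤ f x) → ∀ᵐ x ∂μ, 0 ≤ T f x) :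
    ∃ u : Lp 𝕜 2 μ, (∀ᵐ x ∂μ, 0 ≤ u x) ∧ ‖u‖ ≤ 1 ∧ ‖T u‖ = ‖T‖ := by
  obtain ⟨_, ⟨u, hu, rfl⟩, hmax⟩ := (isCompact_image_closedBall hT).exists_isMaxOn
    ⟨T 0, 0, by simp, rfl⟩ continuous_norm.continuousOn
  have h1 : ‖T‖ ≤ ‖T u‖ := by
    refine ContinuousLinearMap.opNorm_le_of_unit_norm (norm_nonneg _) fun v hv => ?_
    exact hmax ⟨v, by simp [hv], rfl⟩
  have hu1 : ‖absLp u‖ ≤ 1 := by rw [norm_absLp]; simpa using hu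
  refine ⟨absLp u, absLp_nonneg u, hu1, le_antisymm ?_
    (h1.trans (norm_apply_le_norm_apply_absLp hT hpos u))⟩
  simpa using T.le_of_opNorm_le_of_le le_rfl hu1

end Smoothing

/-! ### The nonnegative eigenfunction and the kernels -/

section Kernel

variable {𝕜 : Type*} [RCLike 𝕜] {K : Type*} [MetricSpace K] [CompactSpace K]
  [MeasurableSpace K] [BorelSpace K] {μ : Measure K} [IsFiniteMeasure μ] [μ.IsOpenPosMeasure]
  {S : ℝ → Lp 𝕜 2 μ →L[𝕜] Lp 𝕜 2 μ}

theorem restrictSemigroup_eq_smoothing (hC : ∀ t : ℝ, 0 < t → MapsToC (S t)) {t : ℝ} (ht : 0 < t)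
    (f : C(K, 𝕜)) :
    restrictSemigroup S hC t f = smoothing (hC t ht) (ContinuousMap.toLp 2 μ 𝕜 f) := by
  apply ContinuousMap.toLp_injective (p := 2) (𝕜 := 𝕜) μ
  rw [toLp_restrictSemigroup S hC ht, toLp_smoothing]

theorem nontrivial_Lp [Nonempty K] : Nontrivial (Lp 𝕜 2 μ) := by
  refine ⟨ContinuousMap.toLp 2 μ 𝕜 1, ContinuousMap.toLp 2 μ 𝕜 0, fun h => ?_⟩
  exact one_ne_zero (ContinuousMap.toLp_injective μ h)

/-- The norm of `S_1` is an eigenvalue of `S_1` with a nonnegative eigenfunction, namely a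
function at which the norm of `S_{1/2}` is attained. -/
theorem exists_nonneg_apply_one_eq_smul [Nonempty K] (hS : IsC0Semigroup S)
    (hsym : IsSymmetricFamily S) (hpos : IsPositive S) (hC : ∀ t : ℝ, 0 < t → MapsToC (S t)) :
    ∃ u : Lp 𝕜 2 μ, u ≠ 0 ∧ (∀ᵐ x ∂μ, 0 ≤ u x) ∧ S 1 u = ((‖S 1‖ : ℝ) : 𝕜) • u := by
  have hhalf : (0 : ℝ) < 1 / 2 := by norm_num
  have : Nontrivial (Lp 𝕜 2 μ) := nontrivial_Lp
  have hn := norm_semigroup_pos hS hsym hhalf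
  obtain ⟨u, hu0, hu1, hu⟩ := exists_nonneg_norm_apply_eq (hC _ hhalf) (hpos _ hhalf)
  refine ⟨u, ?_, hu0, ?_⟩
  · rintro rfl
    rw [map_zero, norm_zero] at hu
    exact hn.ne hu
  · set a := ‖S (1 / 2)‖ with ha
    have h1 : ‖S 1‖ = a ^ 2 := (norm_semigroup_half_sq hS.isSemigroup hsym one_pos).symm
    have h2 : ‖S 1 u‖ ≤ a ^ 2 := by
      have := (S 1).le_of_opNorm_le_of_le le_rfl hu1
      rwa [mul_one, h1] at this
    have h3 : RCLike.re (inner 𝕜 (S 1 u) u) = a ^ 2 := by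
      rw [inner_re_symm, inner_semigroup_self hS.isSemigroup hsym one_pos, RCLike.ofReal_re, hu]
    -- the case of equality in the Cauchy-Schwarz inequality
    have h4 : ‖S 1 u - ((a ^ 2 : ℝ) : 𝕜) • u‖ ^ 2 ≤ 0 := by
      rw [@norm_sub_sq 𝕜, inner_smul_right, RCLike.re_ofReal_mul, h3, norm_smul,
        RCLike.norm_ofReal, abs_of_nonneg (sq_nonneg a)]
      have h5 : ‖S 1 u‖ ^ 2 ≤ (a ^ 2) ^ 2 := by gcongr
      have h6 : (a ^ 2 * ‖u‖) ^ 2 ≤ (a ^ 2) ^ 2 := by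
        gcongr; exact mul_le_of_le_one_right (sq_nonneg a) hu1
      linarith
    rw [h1]
    exact sub_eq_zero.1 (norm_eq_zero.1 (pow_eq_zero_iff two_ne_zero |>.1
      (le_antisymm h4 (sq_nonneg _))))

theorem kernelAt_eq_apply (hS : IsSemigroup S) (hsym : IsSymmetricFamily S)
    (hC : ∀ t : ℝ, 0 < t → MapsToC (S t)) {r s t : ℝ} (hr : 0 < r) (hs : 0 < s) (ht : 0 < t)
    (hrst : r = s + t) (x : K) : kernelAt (hC r hr) x = S s (kernelAt (hC t ht) x) := by
  subst hrst
  refine ext_inner_right 𝕜 fun f => ?_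
  rw [hsym s hs, ← smoothing_apply_eq_inner, ← smoothing_apply_eq_inner]
  congr 1
  apply ContinuousMap.toLp_injective (p := 2) (𝕜 := 𝕜) μ
  rw [toLp_smoothing, toLp_smoothing, add_comm, hS.add_apply ht hs]

/-- The continuous representative of the kernel `y ↦ p_t(x, y)` of `S_t`, obtained from
`p_t(x, ·) = S_{t/2} p_{t/2}(x, ·)`. -/
def continuousKernel (hC : ∀ t : ℝ, 0 < t → MapsToC (S t)) {t : ℝ} (ht : 0 < t) (x : K) : C(K, 𝕜) :=
  smoothing (hC (t / 2) (half_pos ht)) (kernelAt (hC (t / 2) (half_pos ht)) x)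

theorem toLp_continuousKernel (hS : IsSemigroup S) (hsym : IsSymmetricFamily S)
    (hC : ∀ t : ℝ, 0 < t → MapsToC (S t)) {t : ℝ} (ht : 0 < t) (x : K) :
    ContinuousMap.toLp 2 μ 𝕜 (continuousKernel hC ht x) = kernelAt (hC t ht) x := by
  rw [continuousKernel, toLp_smoothing]
  exact (kernelAt_eq_apply hS hsym hC ht (half_pos ht) (half_pos ht) (add_halves t).symm x).symm

/-- The semigroup law for the kernels. -/
theorem continuousKernel_eq_smoothing (hS : IsSemigroup S) (hsym : IsSymmetricFamily S)
    (hC : ∀ t : ℝ, 0 < t → MapsToC (S t)) {r s t : ℝ} (hr : 0 < r) (hs : 0 < s) (ht : 0 < t)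
    (hrst : r = s + t) (x : K) :
    continuousKernel hC hr x
      = smoothing (hC s hs) (ContinuousMap.toLp 2 μ 𝕜 (continuousKernel hC ht x)) := by
  apply ContinuousMap.toLp_injective (p := 2) (𝕜 := 𝕜) μ
  rw [toLp_smoothing, toLp_continuousKernel hS hsym, toLp_continuousKernel hS hsym]
  exact kernelAt_eq_apply hS hsym hC hr hs ht hrst x

/-- If some `S_t` does not vanish at `x`, then no `S_t` does, and `p_t(x, x) > 0` for all `t`. -/
theorem continuousKernel_self_ne_zero (hS : IsC0Semigroup S) (hsym : IsSymmetricFamily S)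
    (hC : ∀ t : ℝ, 0 < t → MapsToC (S t)) {x : K} {s : ℝ} (hs : 0 < s)
    (hsx : kernelAt (hC s hs) x ≠ 0) {t : ℝ} (ht : 0 < t) : continuousKernel hC ht x x ≠ 0 := by
  have ht2 := half_pos ht
  rw [continuousKernel, smoothing_apply_eq_inner, inner_self_ne_zero]
  intro h0
  rcases lt_trichotomy s (t / 2) with h | h | h
  · rw [kernelAt_eq_apply hS.isSemigroup hsym hC ht2 (sub_pos.2 h) hs (by ring)] at h0
    exact hsx (semigroup_injective hS hsym (sub_pos.2 h) h0)
  · subst h; exact hsx h0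
  · rw [kernelAt_eq_apply hS.isSemigroup hsym hC hs (sub_pos.2 h) ht2 (by ring), h0,
      map_zero] at hsx
    exact hsx rfl

theorem continuousKernel_nonneg (hpos : IsPositive S) (hC : ∀ t : ℝ, 0 < t → MapsToC (S t)) {t : ℝ}
    (ht : 0 < t) (x y : K) : 0 ≤ continuousKernel hC ht x y :=
  smoothing_nonneg _ (hpos _ (half_pos ht)) (kernelAt_nonneg _ (hpos _ (half_pos ht)) x) y

theorem apply_eq_zero_of_smoothing_eq_zero (hS : IsSemigroup S) (hsym : IsSymmetricFamily S)
    (hpos : IsPositive S) (hC : ∀ t : ℝ, 0 < t → MapsToC (S t)) {t : ℝ} (ht : 0 < t) {f : C(K, 𝕜)}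
    (hf : ∀ x, 0 ≤ f x) {x y : K}
    (h : smoothing (hC t ht) (ContinuousMap.toLp 2 μ 𝕜 f) x = 0)
    (hy : continuousKernel hC ht x y ≠ 0) : f y = 0 := by
  rw [smoothing_apply_eq_inner, ← toLp_continuousKernel hS hsym] at h
  exact (mul_eq_zero_of_inner_toLp_eq_zero (continuousKernel_nonneg hpos hC ht x) hf h
    y).resolve_left hy

/-- If no kernel vanishes on the diagonal, then no kernel vanishes anywhere. The set of all `y`
such that `p_s(x, y) = 0` for all `s` is open and closed and so it is empty. On the other hand
`p_t(x, y) = 0` implies that `p_s(x, y) = 0` for all `s ≤ t`, and then for all `s` by analyticity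
in `s`. -/
theorem continuousKernel_ne_zero [PreconnectedSpace K] (hS : IsC0Semigroup S)
    (hsym : IsSymmetricFamily S) (hpos : IsPositive S) (hC : ∀ t : ℝ, 0 < t → MapsToC (S t))
    (hdiag : ∀ (x : K) (t : ℝ) (ht : 0 < t), continuousKernel hC ht x x ≠ 0) {t : ℝ} (ht : 0 < t)
    (x y : K) : continuousKernel hC ht x y ≠ 0 := by
  -- since `p_{s+t}(x, y)` is the integral of `p_s(y, w) p_t(x, w)` over `w`
  have back : ∀ {r s t : ℝ} (hr : 0 < r) (hs : 0 < s) (ht : 0 < t) (_ : r = s + t) {y w : K},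
      continuousKernel hC hr x y = 0 → continuousKernel hC hs y w ≠ 0 →
        continuousKernel hC ht x w = 0 := by
    intro r s t hr hs ht hrst y w h hw
    rw [continuousKernel_eq_smoothing hS.isSemigroup hsym hC hr hs ht hrst] at h
    exact apply_eq_zero_of_smoothing_eq_zero hS.isSemigroup hsym hpos hC hs
      (continuousKernel_nonneg hpos hC ht x) h hw
  set Z : Set K := {y | ∀ s (hs : 0 < s), continuousKernel hC hs x y = 0} with hZ
  have hclosed : IsClosed Z := by
    have e : Z = ⋂ (s : ℝ) (hs : 0 < s), {y | continuousKernel hC hs x y = 0} := by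
      ext y; simp [hZ]
    rw [e]
    exact isClosed_iInter fun s => isClosed_iInter fun hs =>
      isClosed_eq (continuousKernel hC hs x).continuous continuous_const
  have hopen : IsOpen Z := by
    rw [isOpen_iff_mem_nhds]
    intro y hy
    filter_upwards [(continuousKernel hC one_pos y).continuous.continuousAt.eventually_ne
      (hdiag y 1 one_pos)] with w hw s hs
    exact back (add_pos one_pos hs) one_pos hs rfl (hy _ _) hw
  have hempty : Z = ∅ := by
    refine (isClopen_iff.1 ⟨hclosed, hopen⟩).resolve_right fun h => ?_
    have hx : x ∈ Z := h ▸ Set.mem_univ x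
    exact hdiag x 1 one_pos (hx 1 one_pos)
  intro h0
  have hsmall : ∀ s (hs : 0 < s), s ≤ t → continuousKernel hC hs x y = 0 := by
    intro s hs hst
    rcases hst.eq_or_lt with rfl | hlt
    · exact h0
    · exact back ht (sub_pos.2 hlt) hs (by ring) h0 (hdiag y _ _)
  have h4 : 0 < t / 4 := by positivity
  -- splitting off `t / 4` at both ends gives a function as in `re_inner_semigroup_eq_zero`
  have hin : ∀ b, 0 < b → ∀ r (hr : 0 < r), r = t / 4 + (b + t / 4) →
      continuousKernel hC hr x y
        = inner 𝕜 (kernelAt (hC _ h4) y) (S b (kernelAt (hC _ h4) x)) := by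
    intro b hb r hr e
    rw [continuousKernel_eq_smoothing hS.isSemigroup hsym hC hr h4 (add_pos hb h4) e,
      smoothing_apply_eq_inner, toLp_continuousKernel hS.isSemigroup hsym,
      kernelAt_eq_apply hS.isSemigroup hsym hC (add_pos hb h4) hb h4 rfl]
  have hy : y ∈ Z := by
    intro s hs
    rcases le_or_gt s (t / 2) with h | h
    · exact hsmall s hs (by linarith)
    have hb : 0 < s - t / 2 := sub_pos.2 h
    have hre := re_inner_semigroup_eq_zero hS hsym (isCompactOperator_of_mapsToC (hC 1 one_pos))
      (half_pos ht) (g := kernelAt (hC _ h4) y) (h := kernelAt (hC _ h4) x) (fun b hb hbt => by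
        rw [← hin b hb _ (by positivity) rfl, hsmall _ _ (by linarith), map_zero]) hb
    rw [← hin _ hb s hs (by ring)] at hre
    exact RCLike.ext (by rw [hre, map_zero])
      (by rw [(RCLike.nonneg_iff.1 (continuousKernel_nonneg hpos hC hs x y)).2, map_zero])
  rw [hempty] at hy
  exact hy

end Kernel

/-! ### Closed ideals of `C(K)` and irreducibility -/

section Irreducibility

variable {𝕜 : Type*} [RCLike 𝕜] {K : Type*} [TopologicalSpace K]

/-- The closed ideal of all continuous functions that vanish on a set `N`. -/
def vanishingIdeal (N : Set K) : Submodule 𝕜 C(K, 𝕜) where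
  carrier := {f | ∀ x ∈ N, f x = 0}
  zero_mem' := fun _ _ => rfl
  add_mem' := fun hf hg x hx => by rw [ContinuousMap.add_apply, hf x hx, hg x hx, add_zero]
  smul_mem' := fun c f hf x hx => by rw [ContinuousMap.smul_apply, hf x hx, smul_zero]

theorem mem_vanishingIdeal {N : Set K} {f : C(K, 𝕜)} :
    f ∈ (vanishingIdeal N : Submodule 𝕜 C(K, 𝕜)) ↔ ∀ x ∈ N, f x = 0 :=
  Iff.rfl

theorem isClosed_vanishingIdeal (N : Set K) :
    IsClosed ((vanishingIdeal N : Submodule 𝕜 C(K, 𝕜)) : Set C(K, 𝕜)) := by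
  have e : ((vanishingIdeal N : Submodule 𝕜 C(K, 𝕜)) : Set C(K, 𝕜)) = ⋂ x ∈ N, {f | f x = 0} := by
    ext f; simp [mem_vanishingIdeal]
  rw [e]
  exact isClosed_biInter fun x _ => isClosed_eq (continuous_eval_const x)
    continuous_const

theorem isLatticeIdeal_vanishingIdeal (N : Set K) :
    IsLatticeIdeal (vanishingIdeal N : Submodule 𝕜 C(K, 𝕜)) where
  modulus_mem := fun u hu x hx => by
    have : modulus u x = ((‖u x‖ : ℝ) : 𝕜) := rfl
    rw [this, hu x hx, norm_zero, RCLike.ofReal_zero]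
  mem_of_le := fun u hu v hv hvu x hx => le_antisymm ((hvu x).trans_eq (hu x hx)) (hv x)

theorem modulus_nonneg (f : C(K, 𝕜)) (x : K) : 0 ≤ modulus f x :=
  RCLike.ofReal_nonneg.2 (norm_nonneg (f x))

theorem modulus_ne_zero {f : C(K, 𝕜)} (hf : f ≠ 0) : modulus f ≠ 0 := by
  intro h
  refine hf (ContinuousMap.ext fun x => ?_)
  have h1 : ((‖f x‖ : ℝ) : 𝕜) = 0 := congrArg (fun g : C(K, 𝕜) => g x) h
  simpa using h1

/-- For an irreducible semigroup there is no point at which all `T_t f` vanish, as otherwise the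
range of all `T_t` is contained in a proper closed ideal. -/
theorem IsIrreducible.exists_apply_ne_zero {T : ℝ → C(K, 𝕜) →L[𝕜] C(K, 𝕜)} (hT : IsIrreducible T)
    (hT0 : ∃ t : ℝ, 0 < t ∧ T t ≠ 0) (x : K) : ∃ t : ℝ, 0 < t ∧ ∃ f : C(K, 𝕜), T t f x ≠ 0 := by
  by_contra! h
  rcases hT (vanishingIdeal {x}) (isClosed_vanishingIdeal _) (isLatticeIdeal_vanishingIdeal _)
    (fun t ht f _ y hy => hy ▸ h t ht f) with h1 | h1
  · obtain ⟨t, ht, hne⟩ := hT0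
    refine hne (ContinuousLinearMap.ext fun f => ?_)
    have : T t f ∈ (vanishingIdeal {x} : Submodule 𝕜 C(K, 𝕜)) := fun y hy => hy ▸ h t ht f
    rw [h1] at this
    exact this
  · have : (1 : C(K, 𝕜)) ∈ (vanishingIdeal {x} : Submodule 𝕜 C(K, 𝕜)) := by
      rw [h1]; trivial
    exact one_ne_zero (this x rfl)

variable [CompactSpace K]

theorem exists_pos_isLeast_range [Nonempty K] {g : C(K, 𝕜)} (hg : ∀ x, 0 < g x) :
    ∃ m : ℝ, 0 < m ∧ IsLeast (Set.range g) (m : 𝕜) := by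
  have hc : Continuous fun x => RCLike.re (g x) := RCLike.continuous_re.comp g.continuous
  obtain ⟨x₀, -, hx₀⟩ := isCompact_univ.exists_isMinOn Set.univ_nonempty hc.continuousOn
  refine ⟨RCLike.re (g x₀), (RCLike.pos_iff.1 (hg x₀)).1, ⟨x₀, ?_⟩, ?_⟩
  · exact RCLike.ext (by simp) (by simp [(RCLike.pos_iff.1 (hg x₀)).2])
  · rintro _ ⟨x, rfl⟩
    rw [RCLike.le_iff_re_im, RCLike.ofReal_re, RCLike.ofReal_im]
    exact ⟨hx₀ (Set.mem_univ x), (RCLike.pos_iff.1 (hg x)).2.symm⟩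

/-- A lattice ideal that contains a strictly positive function is everything: it contains all
nonnegative functions, and these span `C(K)`. -/
theorem IsLatticeIdeal.eq_top [Nonempty K] {I : Submodule 𝕜 C(K, 𝕜)} (hI : IsLatticeIdeal I)
    {g : C(K, 𝕜)} (hgI : g ∈ I) (hg : ∀ x, 0 < g x) : I = ⊤ := by
  obtain ⟨δ, hδ, -, hle⟩ := exists_pos_isLeast_range hg
  have hnn : ∀ v : C(K, ℝ), (∀ x, 0 ≤ v x) →
      (⟨fun x => ((v x : ℝ) : 𝕜), by fun_prop⟩ : C(K, 𝕜)) ∈ I := by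
    intro v hv
    refine hI.mem_of_le (((‖v‖ / δ : ℝ) : 𝕜) • g) (I.smul_mem _ hgI) _
      (fun x => RCLike.ofReal_nonneg.2 (hv x)) fun x => ?_
    have h1 : v x ≤ ‖v‖ := (le_abs_self _).trans (v.norm_coe_le_norm x)
    have h2 : ((v x : ℝ) : 𝕜) ≤ ((‖v‖ / δ : ℝ) : 𝕜) * (δ : 𝕜) := by
      rw [← RCLike.ofReal_mul, div_mul_cancel₀ _ hδ.ne', RCLike.ofReal_le_ofReal]
      exact h1
    exact h2.trans (mul_le_mul_of_nonneg_left (hle ⟨x, rfl⟩)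
      (RCLike.ofReal_nonneg.2 (by positivity)))
  have hreal : ∀ v : C(K, ℝ), (⟨fun x => ((v x : ℝ) : 𝕜), by fun_prop⟩ : C(K, 𝕜)) ∈ I := by
    intro v
    have h1 := I.sub_mem (hnn ⟨fun x => max (v x) 0, by fun_prop⟩ fun x => le_max_right _ _)
      (hnn ⟨fun x => max (-v x) 0, by fun_prop⟩ fun x => le_max_right _ _)
    convert h1 using 1
    ext x
    simp only [ContinuousMap.coe_mk, ContinuousMap.sub_apply, ← RCLike.ofReal_sub]
    rw [max_zero_sub_max_neg_zero_eq_self]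
  rw [Submodule.eq_top_iff']
  intro f
  have h1 := I.add_mem
    (hreal ⟨fun x => RCLike.re (f x), RCLike.continuous_re.comp f.continuous⟩)
    (I.smul_mem (RCLike.I : 𝕜)
      (hreal ⟨fun x => RCLike.im (f x), RCLike.continuous_im.comp f.continuous⟩))
  convert h1 using 1
  ext x
  simp only [ContinuousMap.add_apply, ContinuousMap.smul_apply, ContinuousMap.coe_mk, smul_eq_mul]
  rw [mul_comm, RCLike.re_add_im]

theorem isIrreducible_of_forall_pos [Nonempty K] {T : ℝ → C(K, 𝕜) →L[𝕜] C(K, 𝕜)}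
    (h : ∀ f : C(K, 𝕜), (∀ x, 0 ≤ f x) → f ≠ 0 → ∀ t : ℝ, 0 < t → ∀ x : K, 0 < T t f x) :
    IsIrreducible T := by
  intro I _ hI hinv
  by_cases hbot : I = ⊥
  · exact Or.inl hbot
  obtain ⟨f, hf, hf0⟩ := (Submodule.ne_bot_iff I).1 hbot
  exact Or.inr (hI.eq_top (hinv 1 one_pos _ (hI.modulus_mem f hf))
    (h _ (modulus_nonneg f) (modulus_ne_zero hf0) 1 one_pos))

end Irreducibility

/-! ### Zeros of the eigenfunction and strict positivity -/

section Equivalence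

variable {𝕜 : Type*} [RCLike 𝕜] {K : Type*} [MetricSpace K] [CompactSpace K]
  [MeasurableSpace K] [BorelSpace K] {μ : Measure K} [IsFiniteMeasure μ] [μ.IsOpenPosMeasure]
  {S : ℝ → Lp 𝕜 2 μ →L[𝕜] Lp 𝕜 2 μ}

theorem kernelAt_ne_zero_of_apply_ne_zero {T : Lp 𝕜 2 μ →L[𝕜] Lp 𝕜 2 μ} (hT : MapsToC T)
    {f : Lp 𝕜 2 μ} {x : K} (h : smoothing hT f x ≠ 0) : kernelAt hT x ≠ 0 := by
  intro h0
  rw [smoothing_apply_eq_inner, h0, inner_zero_left] at h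
  exact h rfl

theorem restrictSemigroup_one_ne_zero [Nonempty K] (hS : IsC0Semigroup S)
    (hsym : IsSymmetricFamily S) (hC : ∀ t : ℝ, 0 < t → MapsToC (S t)) :
    restrictSemigroup S hC 1 ≠ 0 := by
  intro h
  have h1 := toLp_restrictSemigroup S hC one_pos (1 : C(K, 𝕜))
  rw [h, _root_.zero_apply, map_zero] at h1
  have h2 := semigroup_injective hS hsym one_pos h1.symm
  rw [← map_zero (ContinuousMap.toLp (E := 𝕜) 2 μ 𝕜)] at h2
  exact one_ne_zero (ContinuousMap.toLp_injective μ h2)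

theorem smoothing_toLp_of_eigenvector {T : Lp 𝕜 2 μ →L[𝕜] Lp 𝕜 2 μ} (hT : MapsToC T) {c : 𝕜}
    {v : C(K, 𝕜)} (hv : T (ContinuousMap.toLp 2 μ 𝕜 v) = c • ContinuousMap.toLp 2 μ 𝕜 v) :
    smoothing hT (ContinuousMap.toLp 2 μ 𝕜 v) = c • v := by
  apply ContinuousMap.toLp_injective (p := 2) (𝕜 := 𝕜) μ
  rw [toLp_smoothing, hv, map_smul]

/-- The continuous representative of a nonnegative eigenfunction has no zeros, as its set of zeros
is closed and, since `p_1(x, x) > 0` for all `x`, also open. -/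
theorem exists_toLp_eq_and_forall_pos [PreconnectedSpace K] (hS : IsSemigroup S)
    (hsym : IsSymmetricFamily S) (hpos : IsPositive S) (hC : ∀ t : ℝ, 0 < t → MapsToC (S t))
    (hdiag : ∀ x : K, continuousKernel hC one_pos x x ≠ 0) {c : 𝕜} (hc : c ≠ 0) {u : Lp 𝕜 2 μ}
    (hu0 : u ≠ 0) (hu : ∀ᵐ x ∂μ, 0 ≤ u x) (huc : S 1 u = c • u) :
    ∃ v : C(K, 𝕜), ContinuousMap.toLp 2 μ 𝕜 v = u ∧ ∀ x, 0 < v x := by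
  set v : C(K, 𝕜) := c⁻¹ • smoothing (hC 1 one_pos) u with hv
  have hvu : ContinuousMap.toLp 2 μ 𝕜 v = u := by
    rw [hv, map_smul, toLp_smoothing, huc, inv_smul_smul₀ hc]
  have hv0 : ∀ x, 0 ≤ v x := by
    refine nonneg_of_ae_nonneg (μ := μ) ?_
    have h1 := ContinuousMap.coeFn_toLp (p := 2) (𝕜 := 𝕜) μ v
    rw [hvu] at h1
    filter_upwards [h1, hu] with x h1 h2
    rwa [← h1]
  refine ⟨v, hvu, fun x => (hv0 x).lt_of_ne' fun hx => ?_⟩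
  have hclopen : IsClopen {y | v y = 0} := by
    refine ⟨isClosed_eq v.continuous continuous_const, isOpen_iff_mem_nhds.2 fun y hy => ?_⟩
    filter_upwards [(continuousKernel hC one_pos y).continuous.continuousAt.eventually_ne
      (hdiag y)] with w hw
    -- `v y = 0` implies `(S_1 v)(y) = 0`, and so `v` vanishes where `p_1(y, ·)` does not
    refine apply_eq_zero_of_smoothing_eq_zero hS hsym hpos hC one_pos hv0 ?_ hw
    rw [smoothing_toLp_of_eigenvector (c := c) _ (by rw [hvu, huc]), ContinuousMap.smul_apply,
      show v y = 0 from hy, smul_zero]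
  have huniv := hclopen.eq_univ ⟨x, hx⟩
  refine hu0 ?_
  have hv00 : v = 0 := ContinuousMap.ext fun y => (huniv ▸ Set.mem_univ y : y ∈ {y | v y = 0})
  rw [← hvu, hv00, map_zero]

theorem restrictSemigroup_pos (hS : IsSemigroup S) (hsym : IsSymmetricFamily S)
    (hpos : IsPositive S) (hC : ∀ t : ℝ, 0 < t → MapsToC (S t)) {t : ℝ} (ht : 0 < t) {x : K}
    (hker : ∀ y, continuousKernel hC ht x y ≠ 0) {f : C(K, 𝕜)} (hf : ∀ x, 0 ≤ f x) (hf0 : f ≠ 0) :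
    0 < restrictSemigroup S hC t f x := by
  rw [restrictSemigroup_eq_smoothing hC ht]
  refine (smoothing_nonneg _ (hpos t ht) ?_ x).lt_of_ne' fun h => hf0 ?_
  · filter_upwards [ContinuousMap.coeFn_toLp (p := 2) (𝕜 := 𝕜) μ f] with y hy
    rw [hy]
    exact hf y
  · exact ContinuousMap.ext fun y =>
      apply_eq_zero_of_smoothing_eq_zero hS hsym hpos hC ht hf h (hker y)

end Equivalence

end SemigroupCK

end

theorem proposition2p3 {𝕜 : Type*} [RCLike 𝕜]
    {K : Type*} [MetricSpace K] [CompactSpace K] [ConnectedSpace K]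
    [MeasurableSpace K] [BorelSpace K]
    (μ : Measure K) [IsFiniteMeasure μ] [μ.IsOpenPosMeasure]
    (S : ℝ → Lp 𝕜 2 μ →L[𝕜] Lp 𝕜 2 μ)
    (hS : SemigroupCK.IsC0Semigroup S)
    (hpos : SemigroupCK.IsPositive S)
    (A : Lp 𝕜 2 μ →ₗ.[𝕜] Lp 𝕜 2 μ)
    (hA : SemigroupCK.generator S = -A)
    (hsa : IsSelfAdjoint A)
    (hC : ∀ t : ℝ, 0 < t → SemigroupCK.MapsToC (S t)) :
    -- the first eigenfunction exists
    (∃ u₁ : Lp 𝕜 2 μ, SemigroupCK.IsFirstEigenfunction A u₁) ∧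
    -- and, whichever one is chosen, the four conditions are equivalent
    (∀ u₁ : Lp 𝕜 2 μ, SemigroupCK.IsFirstEigenfunction A u₁ →
      List.TFAE [
        SemigroupCK.IsIrreducible (SemigroupCK.restrictSemigroup S hC),
        ∀ x : K, ∃ t : ℝ, 0 < t ∧ ∃ f : C(K, 𝕜), SemigroupCK.restrictSemigroup S hC t f x ≠ 0,
        ∃ v : C(K, 𝕜), ContinuousMap.toLp 2 μ 𝕜 v = u₁ ∧
          ∃ δ : ℝ, 0 < δ ∧ ∀ x : K, (δ : 𝕜) ≤ v x,
        ∀ f : C(K, 𝕜), (∀ x, 0 ≤ f x) → f ≠ 0 →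
          ∀ t : ℝ, 0 < t → ∀ x : K, 0 < SemigroupCK.restrictSemigroup S hC t f x]) ∧
    -- the case of a strongly continuous restriction
    (SemigroupCK.IsC0Semigroup (SemigroupCK.restrictSemigroup S hC) →
      SemigroupCK.IsIrreducible (SemigroupCK.restrictSemigroup S hC) ∧
      ∀ u₁ : Lp 𝕜 2 μ, SemigroupCK.IsFirstEigenfunction A u₁ →
        ∃ v : C(K, 𝕜), ContinuousMap.toLp 2 μ 𝕜 v = u₁ ∧
          ∃ m : ℝ, 0 < m ∧ IsLeast (Set.range v) (m : 𝕜)) := by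
  open SemigroupCK in
  have : Nontrivial (Lp 𝕜 2 μ) := nontrivial_Lp
  have hsym : IsSymmetricFamily S := fun t ht => inner_semigroup_eq hS hA hsa ht
  obtain ⟨u₀, hu₀, hu₀nn, hu₀ev⟩ := exists_nonneg_apply_one_eq_smul hS hsym hpos hC
  obtain ⟨hleast, hev₀⟩ := isLeast_unboundedSpectrum hS hA hsa hu₀ hu₀ev
  have hfirst : IsFirstEigenfunction A u₀ := ⟨_, hleast, hev₀, hu₀nn⟩
  have htfae : ∀ u₁ : Lp 𝕜 2 μ, IsFirstEigenfunction A u₁ →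
      List.TFAE [
        IsIrreducible (restrictSemigroup S hC),
        ∀ x : K, ∃ t : ℝ, 0 < t ∧ ∃ f : C(K, 𝕜), restrictSemigroup S hC t f x ≠ 0,
        ∃ v : C(K, 𝕜), ContinuousMap.toLp 2 μ 𝕜 v = u₁ ∧
          ∃ δ : ℝ, 0 < δ ∧ ∀ x : K, (δ : 𝕜) ≤ v x,
        ∀ f : C(K, 𝕜), (∀ x, 0 ≤ f x) → f ≠ 0 →
          ∀ t : ℝ, 0 < t → ∀ x : K, 0 < restrictSemigroup S hC t f x] := by
    rintro u₁ ⟨z, hz, hu₁, hu₁nn⟩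
    obtain rfl := hz.unique hleast
    have hu₁S := semigroup_apply_of_isEigenvector hS hA hu₁ one_pos
    set c : 𝕜 := ((Real.exp (-(-Real.log ‖S 1‖ * 1)) : ℝ) : 𝕜) with hc
    have hc0 : c ≠ 0 := RCLike.ofReal_ne_zero.2 (Real.exp_pos _).ne'
    tfae_have 1 → 2 := fun h x =>
      h.exists_apply_ne_zero ⟨1, one_pos, restrictSemigroup_one_ne_zero hS hsym hC⟩ x
    tfae_have 2 → 3 := by
      intro h
      have hdiag : ∀ x : K, continuousKernel hC one_pos x x ≠ 0 := by
        intro x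
        obtain ⟨t, ht, f, hf⟩ := h x
        rw [restrictSemigroup_eq_smoothing hC ht] at hf
        exact continuousKernel_self_ne_zero hS hsym hC ht
          (kernelAt_ne_zero_of_apply_ne_zero _ hf) one_pos
      obtain ⟨v, hv, hvpos⟩ := exists_toLp_eq_and_forall_pos hS.isSemigroup hsym hpos hC hdiag hc0
        hu₁.1 hu₁nn hu₁S
      obtain ⟨m, hm, -, hle⟩ := exists_pos_isLeast_range hvpos
      exact ⟨v, hv, m, hm, fun x => hle ⟨x, rfl⟩⟩
    tfae_have 3 → 4 := by
      rintro ⟨v, rfl, δ, hδ, hle⟩ f hf hf0 t ht x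
      have hdiag : ∀ (x : K) (t : ℝ) (ht : 0 < t), continuousKernel hC ht x x ≠ 0 := by
        intro x t ht
        refine continuousKernel_self_ne_zero hS hsym hC one_pos
          (kernelAt_ne_zero_of_apply_ne_zero (f := ContinuousMap.toLp 2 μ 𝕜 v) _ ?_) ht
        rw [smoothing_toLp_of_eigenvector _ hu₁S, ContinuousMap.smul_apply]
        exact smul_ne_zero hc0 ((RCLike.ofReal_pos.2 hδ).trans_le (hle x)).ne'
      exact restrictSemigroup_pos hS.isSemigroup hsym hpos hC ht
        (continuousKernel_ne_zero hS hsym hpos hC hdiag ht x) hf hf0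
    tfae_have 4 → 1 := isIrreducible_of_forall_pos
    tfae_finish
  refine ⟨⟨u₀, hfirst⟩, htfae, fun hcont => ?_⟩
  have h2 : ∀ x : K, ∃ t : ℝ, 0 < t ∧ ∃ f : C(K, 𝕜), restrictSemigroup S hC t f x ≠ 0 := by
    intro x
    have h1 : Tendsto (fun t => restrictSemigroup S hC t 1 x) (𝓝[>] 0) (𝓝 ((1 : C(K, 𝕜)) x)) :=
      ((continuous_eval_const x).tendsto _).comp (hcont.tendsto_zero 1)
    obtain ⟨t, hne, ht⟩ := ((h1.eventually_ne one_ne_zero).and self_mem_nhdsWithin).exists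
    exact ⟨t, ht, 1, hne⟩
  refine ⟨((htfae u₀ hfirst).out 0 1).2 h2, fun u₁ hu₁ => ?_⟩
  obtain ⟨v, hv, δ, hδ, hle⟩ := ((htfae u₁ hu₁).out 1 2).1 h2
  exact ⟨v, hv, exists_pos_isLeast_range fun x => (RCLike.ofReal_pos.2 hδ).trans_le (hle x)⟩
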